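/- Let $K$ be a field of characteristic $0$, complete with respect to a discrete nontrivial non-archimedean absolute value $|\cdot|$, and let $\mathfrak u\in K$ be a uniformizer. Write $\overline D(a,r)=\{z\in K:|z-a|\le r\}$, and call a closed disk rational if its diameter lies in $|K\setminus\{0\}|$. Equip $\mathbb P^1(K)=K\cup\{\infty\}$ with the chordal metric. For $\phi\in K(z)$ of degree at least $2$, the Fatou set is the largest open subset of $\mathbb P^1(K)$ on which the iterates $\{\phi^{\circ m}\}_{m\ge1}$ are equicontinuous, and the Julia set $\mathcal J(\phi,K)$ is its complement in $\mathbb P^1(K)$. A point $c\in\mathbb P^1(K)$ is a critical point if $\phi$ is not injective on any neighbourhood of $c$, and $\phi$ is hyperbolic if $\mathcal J(\phi,K)$ contains no critical point. Let $n\ge1$ and let $A=(a_{ij})$ be an irreducible $n\times n$ $(0,1)$-matrix; put $\mathcal I_A(i)=\{j: a_{ij}\ne0\}$. Assume that $A$ is admissible, that is: - no row and no column of $A$ is zero, and the non-zero entries in each row are constant (which is automatic for a $(0,1)$-matrix); - if $\mathcal I_A(i_1)\cap\mathcal I_A(i_2)\neq\emptyset$ with $i_1<i_2$, then $\mathcal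 I_A(i_1)\subseteq\mathcal I_A(i_2)$ or $\mathcal I_A(i_2)\subseteq\mathcal I_A(i_1)$; - for each $i$ there is an integer $m\ge1$ such that the $i$-th row of $A^{m}$ has at least two non-zero entries. Let $\overline D_1,\dots,\overline D_n$ be pairwise disjoint rational closed disks in $K$ and let $f:\bigcup_{i=1}^n\overline D_i\to K$ be a map that is linearly compatible to $A$: on each $\overline D_i$ it has the form $f(z)=f_i(z)=\alpha_iz+\beta_i$ with $\alpha_i,\beta_i\in K$, and $\overline D_j\subseteq f(\overline D_i)$ if and only if $a_{ij}=1$. Assume moreover that, for each $1\le i\le n$, $$\overline D_i\subsetneq\overline D(0,1),\qquad \overline D_i\cap\overline D(0,|\mathfrak u|)=\emptyset,\qquad \bigcup_{j\in\mathcal I_A(i)}\overline D_j\subsetneq f(\overline D_i).$$ Put $\overline D_0=\overline D(0,|\mathfrak u|)$ and $f_0(z)=z$. For $0\le i\le n$ choose $a_i\in\overline D_i$ and $x_i\in K$ with $|x_i|=\mathrm{diam}(\overline D_i)$, and put $b_i=x_i/\sqrt{\mathfrak u}$. For an even integer $M\ge 1$ let $$F(z)=\sum_{i=0}^n f_i(z)h_i(z),\qquad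 h_i(z)=\frac1{1-\left(\frac{z-a_i}{b_i}\right)^M}.$$ Then for all sufficiently large even $M$ the following hold: 1. $F\in K(z)$, $F$ has degree at least $2$, and $F$ is hyperbolic; moreover $F$ has no pole in $\mathcal J(F,K)\cap K$ and $F'(z)\neq0$ for every $z\in\mathcal J(F,K)\cap K$. 2. $\mathcal J(F,K)$ is non-empty and compact. 3. $\mathcal J(F,K)\subseteq\bigcup_{i=1}^n\overline D_i$, and $\mathcal J(F,K)\cap\overline D_i\ne\emptyset$ for each $1\le i\le n$. 4. The adjacency matrix of $F$ on $\overline D_1,\dots,\overline D_n$ is $A$; that is, $a_{ij}=1$ if $\overline D_j\subseteq F(\overline D_i)$, and $a_{ij}=0$ otherwise. -/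

import Mathlib

open Set Filter Topology Metric
open scoped Polynomial nonZeroDivisors

namespace NonarchDyn

/-! ### The projective line over a non-archimedean field, with the chordal metric -/

/-- The projective line `P¹(K) = K ∪ {∞}`. -/
inductive ProjLine (K : Type*) where
  | pt (z : K) : ProjLine K
  | infty : ProjLine K

namespace ProjLine

variable {K : Type*}

/-- Homogeneous coordinates: `z ↦ [z : 1]` and `∞ ↦ [1 : 0]`. -/
def coord [Zero K] [One K] : ProjLine K → K × K
  | pt z => (z, 1)
  | infty => (1, 0)

/-- The size `max |X| |Y|` of the homogeneous coordinates `[X : Y]` chosen in `coord`. -/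
noncomputable def size [NormedField K] (P : ProjLine K) : ℝ := max ‖P.coord.1‖ ‖P.coord.2‖

/-- The bracket `X₁ Y₂ - X₂ Y₁`. -/
def wedge [NormedField K] (P Q : ProjLine K) : K :=
  P.coord.1 * Q.coord.2 - Q.coord.1 * P.coord.2

/-- The chordal distance
`|X₁ Y₂ - X₂ Y₁| / (max(|X₁|, |Y₁|) * max(|X₂|, |Y₂|))` on `P¹(K)`. -/
noncomputable def chordal [NormedField K] (P Q : ProjLine K) : ℝ :=
  ‖wedge P Q‖ / (size P * size Q)

section

variable [NormedField K]

theorem size_pos (P : ProjLine K) : 0 < size P := by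
  cases P <;> simp [size, coord]

theorem wedge_swap (P Q : ProjLine K) : wedge P Q = -wedge Q P := by
  simp only [wedge]; ring

theorem wedge_eq_zero {P Q : ProjLine K} (h : wedge P Q = 0) : P = Q := by
  cases P <;> cases Q <;> simp_all [wedge, coord, sub_eq_zero]

theorem wedge_mul_size_le [IsUltrametricDist K] (P Q R : ProjLine K) :
    ‖wedge P R‖ * size Q ≤ max (‖wedge P Q‖ * size R) (‖wedge Q R‖ * size P) := by
  have key : ∀ p q r : K, wedge P R * q = wedge P Q * r + wedge Q R * p →
      ‖p‖ ≤ size P → ‖r‖ ≤ size R →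
      ‖wedge P R‖ * ‖q‖ ≤ max (‖wedge P Q‖ * size R) (‖wedge Q R‖ * size P) := by
    intro p q r h hp hr
    rw [← norm_mul, h]
    refine (IsUltrametricDist.norm_add_le_max _ _).trans ?_
    rw [norm_mul, norm_mul]
    gcongr
  have h1 := key P.coord.1 Q.coord.1 R.coord.1 (by simp only [wedge]; ring)
    (le_max_left _ _) (le_max_left _ _)
  have h2 := key P.coord.2 Q.coord.2 R.coord.2 (by simp only [wedge]; ring)
    (le_max_right _ _) (le_max_right _ _)
  rcases max_choice ‖Q.coord.1‖ ‖Q.coord.2‖ with h | h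
  · rw [show size Q = ‖Q.coord.1‖ from h]; exact h1
  · rw [show size Q = ‖Q.coord.2‖ from h]; exact h2

theorem chordal_le_max [IsUltrametricDist K] (P Q R : ProjLine K) :
    chordal P R ≤ max (chordal P Q) (chordal Q R) := by
  have hP := size_pos P
  have hQ := size_pos Q
  have hR := size_pos R
  have h := wedge_mul_size_le P Q R
  unfold chordal
  rw [le_max_iff] at h ⊢
  refine h.imp (fun h => ?_) (fun h => ?_)
  · rw [div_le_div_iff₀ (by positivity) (by positivity)]
    nlinarith [mul_le_mul_of_nonneg_right h hP.le]
  · rw [div_le_div_iff₀ (by positivity) (by positivity)]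
    nlinarith [mul_le_mul_of_nonneg_right h hR.le]

theorem chordal_nonneg (P Q : ProjLine K) : 0 ≤ chordal P Q :=
  div_nonneg (norm_nonneg _) (mul_pos (size_pos P) (size_pos Q)).le

end

/-- `P¹(K)` with the chordal metric. -/
noncomputable instance [NormedField K] [IsUltrametricDist K] : MetricSpace (ProjLine K) where
  dist := chordal
  dist_self P := by simp [chordal, wedge]
  dist_comm P Q := by
    simp only [chordal]
    rw [wedge_swap P Q, norm_neg, mul_comm (size P)]
  dist_triangle P Q R := (chordal_le_max P Q R).trans
    (max_le_add_of_nonneg (chordal_nonneg P Q) (chordal_nonneg Q R))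
  eq_of_dist_eq_zero {P Q} h := by
    have h' : ‖wedge P Q‖ / (size P * size Q) = 0 := h
    rw [div_eq_zero_iff, norm_eq_zero] at h'
    exact wedge_eq_zero (h'.resolve_right (mul_pos (size_pos P) (size_pos Q)).ne')

end ProjLine

/-! ### Rational maps, Fatou and Julia sets, hyperbolicity -/

section

variable {K : Type*}

open Classical in
/-- The self-map of `P¹(K)` induced by a rational function `φ = p / q` in lowest terms
(in Mathlib, `φ.num` and `φ.denom` are coprime and `φ.denom` is monic). -/
noncomputable def ratMap [Field K] (φ : RatFunc K) : ProjLine K → ProjLine K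
  | .pt z => if φ.denom.eval z = 0 then .infty else .pt (φ.num.eval z / φ.denom.eval z)
  | .infty =>
      if φ.denom.natDegree < φ.num.natDegree then .infty
      else .pt (φ.num.coeff φ.denom.natDegree / φ.denom.leadingCoeff)

/-- The degree of a rational map: the maximum of the degrees of the numerator and of the
denominator in lowest terms. -/
noncomputable def ratDegree [Field K] (φ : RatFunc K) : ℕ :=
  max φ.num.natDegree φ.denom.natDegree

variable [NormedField K] [IsUltrametricDist K]

/-- The `K`-Fatou set: the largest open subset of `P¹(K)` on which the family of iterates
`φ^n`, `n ≥ 1`, is equicontinuous. -/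
def fatouSet (φ : RatFunc K) : Set (ProjLine K) :=
  interior {x | EquicontinuousAt (fun (m : ℕ) => (ratMap φ)^[m + 1]) x}

/-- The `K`-Julia set: the complement of the `K`-Fatou set in `P¹(K)`. -/
def juliaSet (φ : RatFunc K) : Set (ProjLine K) := (fatouSet φ)ᶜ

/-- The `K`-rational critical points: the points having no neighbourhood that `φ` maps
bijectively onto its image. -/
def critSet (φ : RatFunc K) : Set (ProjLine K) :=
  {c | ∀ U ∈ 𝓝 c, ¬ InjOn (ratMap φ) U}

/-- A rational map of degree at least `2` is hyperbolic if no `K`-rational critical point lies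
in its `K`-Julia set. -/
def IsHyperbolic (φ : RatFunc K) : Prop :=
  2 ≤ ratDegree φ ∧ critSet φ ∩ juliaSet φ = ∅

end

/-! ### Admissible matrices -/

/-- Admissible matrices. `{j | A i j ≠ 0}` is the set `I_A(i)`. -/
structure IsAdmissible {n : ℕ} (A : Matrix (Fin n) (Fin n) ℤ) : Prop where
  irreducible : A.IsIrreducible
  row_ne_zero : ∀ i, ∃ j, A i j ≠ 0
  col_ne_zero : ∀ j, ∃ i, A i j ≠ 0
  row_const : ∀ i j k, A i j ≠ 0 → A i k ≠ 0 → A i j = A i k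
  containing : ∀ i₁ i₂, i₁ < i₂ → ({j | A i₁ j ≠ 0} ∩ {j | A i₂ j ≠ 0}).Nonempty →
    {j | A i₁ j ≠ 0} ⊆ {j | A i₂ j ≠ 0} ∨ {j | A i₂ j ≠ 0} ⊆ {j | A i₁ j ≠ 0}
  markov : ∀ i, ∃ m : ℕ, 1 ≤ m ∧ ∃ j k, j ≠ k ∧ (A ^ m) i j ≠ 0 ∧ (A ^ m) i k ≠ 0

/-! ### Piecewise linear maps on disks -/

section

variable {K : Type*} [NormedField K]

/-- `u` is a uniformizer: `0 < |u| < 1` and `|u|` generates the value group `|K ∖ {0}|`.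
The existence of a uniformizer says that the valuation of `K` is discrete and nontrivial. -/
def IsUniformizer (u : K) : Prop :=
  0 < ‖u‖ ∧ ‖u‖ < 1 ∧ ∀ x : K, x ≠ 0 → ∃ k : ℤ, ‖x‖ = ‖u‖ ^ k

/-- A closed disk whose diameter lies in the value group `|K ∖ {0}|`. -/
def IsRationalClosedDisk (D : Set K) : Prop :=
  (∃ (c : K) (r : ℝ), 0 ≤ r ∧ D = closedBall c r) ∧ ∃ x : K, x ≠ 0 ∧ diam D = ‖x‖

/-- `f` (of which only the restriction to `⋃ i, D i` matters) is linearly compatible to `A` on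
the pairwise disjoint rational closed disks `D i`, the disks being labelled according to `A`. -/
structure IsLinearlyCompatible {n : ℕ} (A : Matrix (Fin n) (Fin n) ℤ) (D : Fin n → Set K)
    (f : K → K) : Prop where
  disk : ∀ i, IsRationalClosedDisk (D i)
  disjoint : ∀ i j, i ≠ j → Disjoint (D i) (D j)
  linear : ∀ i, ∃ α β : K, ∀ z ∈ D i, f z = α * z + β
  transition : ∀ i j, D j ⊆ f '' D i ↔ A i j = 1

/-- A subset of `K` regarded as a subset of `P¹(K)`. -/
def inProjLine (S : Set K) : Set (ProjLine K) := ProjLine.pt '' S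

end

open Classical in
/-- The adjacency matrix of a self-map `g` on finitely many sets `U i`: its `(i, j)` entry is `1`
if `U j ⊆ g (U i)` and `0` otherwise. -/
noncomputable def adjacencyMatrix {X : Type*} {n : ℕ} (g : X → X) (U : Fin n → Set X) :
    Matrix (Fin n) (Fin n) ℤ :=
  Matrix.of fun i j => if U j ⊆ g '' U i then 1 else 0

/-! ### Gluing -/

section

variable {L : Type*} [Field L]

/-- The rational function `h(z) = 1 / (1 - ((z - a) / b) ^ M)`. -/
noncomputable def bump (a b : L) (M : ℕ) : RatFunc L :=
  1 / (1 - ((RatFunc.X - RatFunc.C a) / RatFunc.C b) ^ M)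

/-- The linear polynomial `α z + β`, as a rational function. -/
noncomputable def linearFun (α β : L) : RatFunc L :=
  RatFunc.C α * RatFunc.X + RatFunc.C β

/-- The inclusion `K(z) → L(z)` induced by a field extension `L / K`. -/
noncomputable def baseChange (K L : Type*) [Field K] [Field L] [Algebra K L] :
    RatFunc K →+* RatFunc L :=
  RatFunc.mapRingHom (Polynomial.mapRingHom (algebraMap K L))
    (nonZeroDivisors_le_comap_nonZeroDivisors_of_injective _
      (Polynomial.map_injective _ (algebraMap K L).injective))

end

end NonarchDyn

open NonarchDyn

/-! The denominators are arranged so that $|(z-a_i)/b_i|^2$ is $|\mathfrak u|$ times an even power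
of $|\mathfrak u|$ (or zero), hence never $1$: it is at most $|\mathfrak u|$ on $\overline D_i$ and
at least $1/|\mathfrak u|$ off it. So $h_i$ has no pole in $K$, and with $M=2m$ it differs from the
indicator function of $\overline D_i$ by $O(|\mathfrak u|^m)$, in value and in Lipschitz constant on
each disk (`IsUniformizer.exists_glue_estimate`). Consequently $F$ is a tiny perturbation of $f_i$
on $\overline D_i$ and of the identity on $\overline D_0$, is tiny on the rest of the unit ball,
decays outside it, and sends $\infty$ to $0$.

By the ultrametric inequality a small Lipschitz error does not change the scaling factor
$|\alpha_i|$, and by the contraction principle it does not change the image of a disk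
(`SmallOn.norm_map_sub`, `SmallOn.image_closedBall`). Hence $F(\overline D_i)=f(\overline D_i)$,
which gives the adjacency matrix, and $F$ is injective on each $\overline D_i$.

Dynamically, every point outside the $\overline D_i$ falls into $\overline D_0$, where $F$ is
$1$-Lipschitz and stays, so escaping orbits are equicontinuous. On the $\overline D_i$ individual
factors $|\alpha_i|$ may be below $1$, but distance divided by the radius of the current disk grows
by at least $1/|\mathfrak u|$ at each step: $f(\overline D_i)$ strictly contains every disk it
meets, and the value group is discrete. Thus the Julia set is exactly the set of points that never
leave the disks (`IsMarkovRepeller.compl_interior_eq`). It is coded by itineraries, whence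
compactness and non-emptiness, and it has no critical points because the disks are neighbourhoods on
which $F$ is injective. -/

namespace NonarchDyn

/-! ### Expanding Markov maps whose complement is absorbed by a non-expanding region -/

/-- A continuous map `G` that expands the sets `E i` in a Markov fashion, and that sends everything
outside of them into a set `E₀` on which it does not increase distances. -/
structure IsMarkovRepeller {X : Type*} {ι : Type} [MetricSpace X] (G : X → X) (E : ι → Set X)
    (E₀ : Set X) (c r : ι → ℝ) (q : ℝ) : Prop where
  continuous : Continuous G
  complete : ∀ i, IsComplete (E i)
  nonempty : ∀ i, (E i).Nonempty
  r_pos : ∀ i, 0 < r i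
  c_pos : ∀ i, 0 < c i
  q_nonneg : 0 ≤ q
  q_lt_one : q < 1
  dist_le : ∀ i, ∀ x ∈ E i, ∀ y ∈ E i, dist x y ≤ r i
  exists_dist_eq : ∀ i, ∀ x ∈ E i, ∃ y ∈ E i, dist x y = r i
  dist_map : ∀ i j, ∀ x ∈ E i, ∀ y ∈ E i, G x ∈ E j → G y ∈ E j →
    dist (G x) (G y) = c i * dist x y
  subset_image : ∀ i j, ∀ x ∈ E i, G x ∈ E j → E j ⊆ G '' E i
  expanding : ∀ i j, ∀ x ∈ E i, G x ∈ E j → r j ≤ q * (c i * r i)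
  exists_subset_image : ∀ i, ∃ j, E j ⊆ G '' E i
  mapsTo : ∀ x, (∀ i, x ∉ E i) → G x ∈ E₀
  disjoint : ∀ x ∈ E₀, ∀ i, x ∉ E i
  dist_map_le : ∀ x ∈ E₀, ∀ y ∈ E₀, dist (G x) (G y) ≤ dist x y

namespace IsMarkovRepeller

variable {X : Type*} {ι : Type} [MetricSpace X] {G : X → X} {E : ι → Set X}
  {E₀ : Set X} {c r : ι → ℝ} {q : ℝ}

/-- The quantity `dist / r` for the current piece grows by a factor at least `1 / q` per step,
although `dist` alone need not grow. The inequality is kept multiplied out, which also covers `q =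
0`. -/
theorem dist_mul_le (h : IsMarkovRepeller G E E₀ c r q) (k : ℕ) :
    ∀ (w : ℕ → ι) (x y : X), (∀ j ≤ k, G^[j] x ∈ E (w j)) → (∀ j ≤ k, G^[j] y ∈ E (w j)) →
      dist x y * r (w k) ≤ r (w 0) * q ^ k * dist (G^[k] x) (G^[k] y) := by
  induction k with
  | zero => intro w x y _ _; simp [mul_comm]
  | succ k ih =>
    intro w x y hx hy
    have h1 := ih (fun j => w (j + 1)) (G x) (G y) (fun j hj => hx (j + 1) (by omega))
      (fun j hj => hy (j + 1) (by omega))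
    have hx0 := hx 0 (by omega)
    have hy0 := hy 0 (by omega)
    rw [h.dist_map (w 0) (w 1) x hx0 y hy0 (hx 1 (by omega)) (hy 1 (by omega))] at h1
    have h2 := h.expanding (w 0) (w 1) x hx0 (hx 1 (by omega))
    simp only [zero_add, ← Function.iterate_succ_apply] at h1
    have hq := pow_nonneg h.q_nonneg k
    have h3 : r (w 1) * q ^ k * dist (G^[k + 1] x) (G^[k + 1] y) ≤
        q * (c (w 0) * r (w 0)) * q ^ k * dist (G^[k + 1] x) (G^[k + 1] y) := by gcongr
    refine le_of_mul_le_mul_left ?_ (h.c_pos (w 0))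
    calc _ = c (w 0) * dist x y * r (w (k + 1)) := by ring
      _ ≤ _ := h1.trans h3
      _ = _ := by ring

theorem dist_le_of_itinerary (h : IsMarkovRepeller G E E₀ c r q) {k : ℕ} {w : ℕ → ι} {x y : X}
    (hx : ∀ j ≤ k, G^[j] x ∈ E (w j)) (hy : ∀ j ≤ k, G^[j] y ∈ E (w j)) :
    dist x y ≤ r (w 0) * q ^ k := by
  have h1 := h.dist_mul_le k w x y hx hy
  have h2 := h.dist_le _ _ (hx k le_rfl) _ (hy k le_rfl)
  have h3 : r (w 0) * q ^ k * dist (G^[k] x) (G^[k] y) ≤ r (w 0) * q ^ k * r (w k) :=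
    mul_le_mul_of_nonneg_left h2 (mul_nonneg (h.r_pos _).le (pow_nonneg h.q_nonneg _))
  exact le_of_mul_le_mul_right (h1.trans h3) (h.r_pos _)

-- Any point of the last piece can be pulled back step by step along a chain of full transitions.
omit [MetricSpace X] in
theorem exists_itinerary (k : ℕ) : ∀ (w : ℕ → ι), (∀ j < k, E (w (j + 1)) ⊆ G '' E (w j)) →
    ∀ y ∈ E (w k), ∃ x, G^[k] x = y ∧ ∀ j ≤ k, G^[j] x ∈ E (w j) := by
  induction k with
  | zero => exact fun w _ y hy => ⟨y, rfl, fun j hj => by simpa [Nat.le_zero.1 hj] using hy⟩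
  | succ k ih =>
    intro w hw y hy
    obtain ⟨x', h1, h2⟩ := ih (fun j => w (j + 1)) (fun j hj => hw (j + 1) (by omega)) y hy
    obtain ⟨x, hx, rfl⟩ := hw 0 (by omega) (h2 0 (by omega))
    refine ⟨x, h1, fun j hj => ?_⟩
    cases j with
    | zero => exact hx
    | succ j => exact h2 j (by omega)

/-- The points whose forward orbit never leaves the sets `E i`. -/
def nonescaping (G : X → X) (E : ι → Set X) : Set X := {x | ∀ k, ∃ i, G^[k] x ∈ E i}

/-- The points sharing the itinerary of `x` up to time `k` form a set that shrinks to `x`, yet it is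
mapped by `G^[k]` onto a whole piece, whose size is bounded below. -/
theorem not_equicontinuousAt (h : IsMarkovRepeller G E E₀ c r q) [Finite ι] {x : X}
    (hx : x ∈ nonescaping G E) : ¬ EquicontinuousAt (fun m : ℕ => G^[m + 1]) x := by
  choose w hw using hx
  have : Nonempty ι := ⟨w 0⟩
  -- The smallest radius is the `ε` for which equicontinuity fails.
  obtain ⟨i₀, hi₀⟩ := Finite.exists_min r
  intro he
  obtain ⟨δ, hδ, H⟩ := Metric.equicontinuousAt_iff.1 he (r i₀) (h.r_pos _)
  have ht : Tendsto (fun k : ℕ => r (w 0) * q ^ (k + 1)) atTop (𝓝 0) := by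
    simpa using ((tendsto_pow_atTop_nhds_zero_of_lt_one h.q_nonneg h.q_lt_one).comp
      (tendsto_add_atTop_nat 1)).const_mul (r (w 0))
  obtain ⟨k, hk⟩ := (ht.eventually_lt_const hδ).exists
  obtain ⟨y, hy, hd⟩ := h.exists_dist_eq _ _ (hw (k + 1))
  obtain ⟨z, rfl, hz⟩ := exists_itinerary (k + 1) w (fun j _ => h.subset_image _ _ _ (hw j)
    (by have := hw (j + 1); rwa [Function.iterate_succ_apply'] at this)) y hy
  have h1 := h.dist_le_of_itinerary hz (fun j _ => hw j)
  have h2 := H z (h1.trans_lt hk) k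
  exact absurd (hi₀ (w (k + 1))) (by rw [← hd]; exact not_le.2 h2)

theorem iterate_mem (h : IsMarkovRepeller G E E₀ c r q) {x : X} (hx : x ∈ E₀) (k : ℕ) :
    G^[k] x ∈ E₀ := by
  induction k with
  | zero => exact hx
  | succ k ih => rw [Function.iterate_succ_apply']; exact h.mapsTo _ (h.disjoint _ ih)

theorem dist_iterate_le (h : IsMarkovRepeller G E E₀ c r q) {x y : X} (hx : x ∈ E₀) (hy : y ∈ E₀)
    (k : ℕ) : dist (G^[k] x) (G^[k] y) ≤ dist x y := by
  induction k with
  | zero => rfl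
  | succ k ih =>
    rw [Function.iterate_succ_apply', Function.iterate_succ_apply']
    exact (h.dist_map_le _ (h.iterate_mem hx k) _ (h.iterate_mem hy k)).trans ih

theorem isOpen_escaping (h : IsMarkovRepeller G E E₀ c r q) [Finite ι] (k : ℕ) :
    IsOpen {x | ∀ i, G^[k] x ∉ E i} := by
  simp only [ofPred_forall]
  exact isOpen_iInter_of_finite fun i =>
    ((h.complete i).isClosed.preimage (h.continuous.iterate k)).isOpen_compl

/-- Finitely many iterates are controlled by continuity; from time `k + 1` on, nearby orbits lie in
`E₀`, where distances no longer increase. -/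
theorem equicontinuousAt (h : IsMarkovRepeller G E E₀ c r q) [Finite ι] {k : ℕ} {x : X}
    (hx : ∀ i, G^[k] x ∉ E i) : EquicontinuousAt (fun m : ℕ => G^[m + 1]) x := by
  rw [Metric.equicontinuousAt_iff_right]
  intro ε hε
  have h1 : ∀ᶠ y in 𝓝 x, ∀ i, G^[k] y ∉ E i := (h.isOpen_escaping k).mem_nhds hx
  have h2 : ∀ᶠ y in 𝓝 x, ∀ m ∈ Finset.range (k + 1), dist (G^[m + 1] x) (G^[m + 1] y) < ε := by
    rw [Filter.eventually_all_finset]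
    intro m _
    have := (h.continuous.iterate (m + 1)).continuousAt (x := x)
    filter_upwards [this (ball_mem_nhds _ hε)] with y hy
    rw [dist_comm]; exact hy
  filter_upwards [h1, h2] with y hy hy' m
  by_cases hm : m < k + 1
  · exact hy' m (Finset.mem_range.2 hm)
  · obtain ⟨l, rfl⟩ : ∃ l, m = l + k := ⟨m - k, by omega⟩
    have hx0 : G^[k + 1] x ∈ E₀ := by
      rw [Function.iterate_succ_apply']; exact h.mapsTo _ hx
    have hy0 : G^[k + 1] y ∈ E₀ := by
      rw [Function.iterate_succ_apply']; exact h.mapsTo _ hy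
    rw [add_assoc, Function.iterate_add_apply G l, Function.iterate_add_apply G l]
    exact (h.dist_iterate_le hx0 hy0 l).trans_lt (hy' k (by simp))

theorem compl_interior_eq (h : IsMarkovRepeller G E E₀ c r q) [Finite ι] :
    (interior {x | EquicontinuousAt (fun m : ℕ => G^[m + 1]) x})ᶜ = nonescaping G E := by
  ext x
  constructor
  · intro hx
    by_contra hn
    simp only [nonescaping, mem_ofPred_eq, not_forall, not_exists] at hn
    obtain ⟨k, hk⟩ := hn
    exact hx (mem_interior.2 ⟨_, fun y hy => h.equicontinuousAt hy, h.isOpen_escaping k, hk⟩)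
  · exact fun hx hi => h.not_equicontinuousAt hx (interior_subset hi)

/-- The set is closed inside a complete set, and itineraries of bounded length cut it into finitely
many parts of small diameter. -/
theorem isCompact_nonescaping (h : IsMarkovRepeller G E E₀ c r q) [Finite ι] :
    IsCompact (nonescaping G E) := by
  have hU : IsComplete (⋃ i, E i) := by
    classical
    have := Fintype.ofFinite ι
    have key : ∀ s : Finset ι, IsComplete (⋃ i ∈ s, E i) := by
      intro s
      induction s using Finset.induction_on with
      | empty => simpa using (isCompact_empty (X := X)).isComplete
      | insert i s _ ih => rw [Finset.set_biUnion_insert]; exact (h.complete i).union ih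
    simpa using key Finset.univ
  have hcl : IsClosed (nonescaping G E) := by
    have : nonescaping G E = ⋂ k, {x | ∀ i, G^[k] x ∉ E i}ᶜ := by
      ext x; simp [nonescaping]
    rw [this]
    exact isClosed_iInter fun k => (h.isOpen_escaping k).isClosed_compl
  have hsub : nonescaping G E ⊆ ⋃ i, E i := fun x hx => mem_iUnion.2 (hx 0)
  have hcomp : IsComplete (nonescaping G E) := by
    intro l hl hle
    obtain ⟨x, -, hx⟩ := hU l hl (hle.trans (principal_mono.2 hsub))
    have := hl.1
    exact ⟨x, hcl.mem_of_tendsto (f := id) hx (le_principal_iff.1 hle), hx⟩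
  rw [isCompact_iff_totallyBounded_isComplete]
  refine ⟨?_, hcomp⟩
  have := Fintype.ofFinite ι
  refine Metric.totallyBounded_of_finite_discretization fun ε hε => ?_
  rcases isEmpty_or_nonempty ι with hι | hι
  · refine ⟨PUnit, inferInstance, fun _ => ⟨⟩, fun x => ?_⟩
    exact isEmptyElim (x.2 0).choose
  obtain ⟨i₀, hi₀⟩ := Finite.exists_max r
  have ht : Tendsto (fun k : ℕ => r i₀ * q ^ k) atTop (𝓝 0) := by
    simpa using (tendsto_pow_atTop_nhds_zero_of_lt_one h.q_nonneg h.q_lt_one).const_mul (r i₀)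
  obtain ⟨k, hk⟩ := (ht.eventually_lt_const hε).exists
  choose w hw using fun x : nonescaping G E => x.2
  -- The discretization sends a point to the first `k + 1` letters of its itinerary; `ULift` only
  -- adjusts the universe.
  refine ⟨ULift (Fin (k + 1) → ι), inferInstance, fun x => ⟨fun j => w x j⟩, fun x y hxy => ?_⟩
  have hy : ∀ j ≤ k, G^[j] (y : X) ∈ E (w x j) := by
    intro j hj
    have := congrFun (congrArg ULift.down hxy) ⟨j, by omega⟩
    simp only at this
    rw [this]; exact hw y j
  refine (h.dist_le_of_itinerary (w := w x) (fun j _ => hw x j) hy).trans_lt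
    (lt_of_le_of_lt ?_ hk)
  exact mul_le_mul_of_nonneg_right (hi₀ _) (pow_nonneg h.q_nonneg _)

/-- Follow one full transition out of each piece and apply Cantor's intersection theorem to the
nested cylinders of that itinerary. -/
theorem nonempty_nonescaping (h : IsMarkovRepeller G E E₀ c r q) [Finite ι] (i : ι) :
    (nonescaping G E ∩ E i).Nonempty := by
  choose s hs using h.exists_subset_image
  set w : ℕ → ι := fun k => s^[k] i with hw
  have hws : ∀ j, E (w (j + 1)) ⊆ G '' E (w j) := fun j => by
    simp only [hw, Function.iterate_succ_apply']; exact hs _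
  have : CompleteSpace (E i) := (h.complete i).completeSpace_coe
  let C : ℕ → Set (E i) := fun k => {x | ∀ j ≤ k, G^[j] (x : X) ∈ E (w j)}
  have hC : ∀ k, IsClosed (C k) := fun k => by
    simp only [C, ofPred_forall]
    exact isClosed_iInter fun j => isClosed_iInter fun _ => (h.complete _).isClosed.preimage
      ((h.continuous.iterate j).comp continuous_subtype_val)
  have hdist : ∀ k, ∀ x ∈ C k, ∀ y ∈ C k, dist x y ≤ r i * q ^ k := fun k x hx y hy =>
    h.dist_le_of_itinerary (w := w) hx hy
  have hq := fun k => mul_nonneg (h.r_pos i).le (pow_nonneg h.q_nonneg k)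
  obtain ⟨x, hx⟩ := Metric.nonempty_iInter_of_nonempty_biInter (s := C) hC
    (fun k => Metric.isBounded_iff.2 ⟨_, fun x hx y hy => hdist k x hx y hy⟩)
    (fun N => by
      obtain ⟨y, hy⟩ := h.nonempty (w N)
      obtain ⟨x, -, hx⟩ := exists_itinerary N w (fun j _ => hws j) y hy
      exact ⟨⟨x, hx 0 (Nat.zero_le _)⟩, mem_iInter₂.2 fun k hk j hj => hx j (hj.trans hk)⟩)
    (squeeze_zero (fun _ => Metric.diam_nonneg)
      (fun k => Metric.diam_le_of_forall_dist_le (hq k) (hdist k))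
      (by simpa using
        (tendsto_pow_atTop_nhds_zero_of_lt_one h.q_nonneg h.q_lt_one).const_mul (r i)))
  exact ⟨x, fun k => ⟨w k, mem_iInter.1 hx k k le_rfl⟩, x.2⟩

end IsMarkovRepeller

/-! ### Rational functions without finite poles that vanish at infinity -/

section

variable {K : Type*} [Field K]

/-- `F` is a quotient of polynomials whose denominator has no zero in `K`, it has value `g z` at
`z ∈ K`, and it vanishes at infinity. -/
def HasRegularValues (F : RatFunc K) (g : K → K) : Prop :=
  ∃ P Q : K[X], F = algebraMap K[X] (RatFunc K) P / algebraMap K[X] (RatFunc K) Q ∧ Q ≠ 0 ∧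
    (∀ z, Q.eval z ≠ 0) ∧ (∀ z, P.eval z = g z * Q.eval z) ∧ P.degree < Q.degree

theorem HasRegularValues.add {F₁ F₂ : RatFunc K} {g₁ g₂ : K → K} (h₁ : HasRegularValues F₁ g₁)
    (h₂ : HasRegularValues F₂ g₂) : HasRegularValues (F₁ + F₂) (fun z => g₁ z + g₂ z) := by
  obtain ⟨P₁, Q₁, rfl, hQ₁, hQ₁', hP₁, hd₁⟩ := h₁
  obtain ⟨P₂, Q₂, rfl, hQ₂, hQ₂', hP₂, hd₂⟩ := h₂
  refine ⟨P₁ * Q₂ + Q₁ * P₂, Q₁ * Q₂, ?_, mul_ne_zero hQ₁ hQ₂, ?_, ?_, ?_⟩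
  · rw [div_add_div _ _ (RatFunc.algebraMap_ne_zero hQ₁) (RatFunc.algebraMap_ne_zero hQ₂)]
    simp only [map_add, map_mul]
  · intro z; rw [Polynomial.eval_mul]; exact mul_ne_zero (hQ₁' z) (hQ₂' z)
  · intro z; simp only [Polynomial.eval_mul, Polynomial.eval_add, hP₁, hP₂]; ring
  · refine (Polynomial.degree_add_le _ _).trans_lt (max_lt ?_ ?_)
    · rw [Polynomial.degree_mul, Polynomial.degree_mul]
      exact WithBot.add_lt_add_right (by simpa using hQ₂) hd₁
    · rw [Polynomial.degree_mul, Polynomial.degree_mul]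
      exact WithBot.add_lt_add_left (by simpa using hQ₁) hd₂

theorem HasRegularValues.zero : HasRegularValues (0 : RatFunc K) (fun _ => 0) :=
  ⟨0, 1, by simp, one_ne_zero, by simp, by simp, by simp⟩

theorem HasRegularValues.sum {ι : Type*} (s : Finset ι) {F : ι → RatFunc K} {g : ι → K → K}
    (h : ∀ i, HasRegularValues (F i) (g i)) :
    HasRegularValues (∑ i ∈ s, F i) (fun z => ∑ i ∈ s, g i z) := by
  classical
  induction s using Finset.induction_on with
  | empty => simpa using HasRegularValues.zero
  | insert i s hi ih => simp only [Finset.sum_insert hi]; exact (h i).add ih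

/-- The rational function `B / (B - (z - a) ^ M)`, which is `bump a b M` when `B = b ^ M`. -/
noncomputable def bumpOfPow (a B : K) (M : ℕ) : RatFunc K :=
  RatFunc.C B / (RatFunc.C B - (RatFunc.X - RatFunc.C a) ^ M)

theorem hasRegularValues_linearFun_mul_bumpOfPow {α β a B : K} {M : ℕ} (hM : 2 ≤ M)
    (hB : ∀ z, B - (z - a) ^ M ≠ 0) :
    HasRegularValues (linearFun α β * bumpOfPow a B M)
      (fun z => (α * z + β) * (B / (B - (z - a) ^ M))) := by
  open Polynomial in
  have hdeg : ((X - C a : K[X]) ^ M).degree = M := by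
    simp [Polynomial.degree_pow]
  have hQ : (C B - (X - C a) ^ M : K[X]).degree = M := by
    rw [Polynomial.degree_sub_eq_right_of_degree_lt, hdeg]
    rw [hdeg]
    exact Polynomial.degree_C_le.trans_lt (by exact_mod_cast (by omega : 0 < M))
  refine ⟨(C α * X + C β) * C B, C B - (X - C a) ^ M, ?_, ?_, ?_, ?_, ?_⟩
  · simp [linearFun, bumpOfPow, mul_div_assoc]
  · intro h; rw [h] at hQ; simp at hQ
  · intro z; simpa using hB z
  · intro z
    simp only [eval_mul, eval_add, eval_C, eval_X, eval_sub, eval_pow]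
    field_simp [hB z]
  · rw [hQ]
    have h1 : ((C α * X + C β) * C B : K[X]).degree ≤ 1 := by
      rw [Polynomial.degree_mul]
      calc _ ≤ (1 : WithBot ℕ) + 0 := add_le_add degree_linear_le degree_C_le
        _ = 1 := by simp
    exact h1.trans_lt (by exact_mod_cast hM)

/-- Transfers information from an unreduced fraction, which is what sums produce, to `num` and
`denom`. -/
theorem HasRegularValues.num_mul {F : RatFunc K} {P Q : K[X]} (hQ : Q ≠ 0)
    (hF : F = algebraMap K[X] (RatFunc K) P / algebraMap K[X] (RatFunc K) Q) :
    F.num * Q = P * F.denom := by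
  have h1 := F.num_div_denom
  rw [hF] at h1
  rw [div_eq_div_iff (RatFunc.algebraMap_ne_zero (RatFunc.denom_ne_zero _))
    (RatFunc.algebraMap_ne_zero hQ), ← map_mul, ← map_mul] at h1
  rw [hF]
  exact RatFunc.algebraMap_injective K h1

theorem HasRegularValues.denom_eval_ne_zero {F : RatFunc K} {g : K → K}
    (h : HasRegularValues F g) (z : K) : F.denom.eval z ≠ 0 := by
  obtain ⟨P, Q, rfl, hQ, hQ', -, -⟩ := h
  intro h0
  refine hQ' z ?_
  exact Polynomial.eval_eq_zero_of_dvd_of_eval_eq_zero (RatFunc.denom_div_dvd P Q) h0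

theorem HasRegularValues.eval_div {F : RatFunc K} {g : K → K}
    (h : HasRegularValues F g) (z : K) : F.num.eval z / F.denom.eval z = g z := by
  have hd := h.denom_eval_ne_zero z
  obtain ⟨P, Q, hF, hQ, hQ', hP, -⟩ := h
  have h1 := congrArg (Polynomial.eval z) (num_mul hQ hF)
  rw [Polynomial.eval_mul, Polynomial.eval_mul, hP] at h1
  rw [div_eq_iff hd]
  exact mul_right_cancel₀ (hQ' z) (by rw [h1]; ring)

theorem HasRegularValues.degree_num_lt {F : RatFunc K} {g : K → K}
    (h : HasRegularValues F g) : F.num.degree < F.denom.degree := by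
  obtain ⟨P, Q, hF, hQ, -, -, hd⟩ := h
  have h1 := congrArg Polynomial.degree (num_mul hQ hF)
  rw [Polynomial.degree_mul, Polynomial.degree_mul] at h1
  by_contra hc
  rw [not_lt] at hc
  have h2 : P.degree + F.denom.degree < Q.degree + F.denom.degree :=
    WithBot.add_lt_add_right (by simpa using RatFunc.denom_ne_zero F) hd
  rw [← h1, add_comm] at h2
  exact absurd (add_le_add_right hc Q.degree) (not_le.2 h2)

theorem HasRegularValues.ratMap_pt {F : RatFunc K} {g : K → K} (h : HasRegularValues F g) (z : K) :
    ratMap F (.pt z) = .pt (g z) := by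
  simp only [ratMap, if_neg (h.denom_eval_ne_zero z), h.eval_div z]

theorem HasRegularValues.ratMap_infty {F : RatFunc K} {g : K → K} (h : HasRegularValues F g) :
    ratMap F .infty = .pt 0 := by
  have h1 := h.degree_num_lt
  have h2 : ¬ F.denom.natDegree < F.num.natDegree :=
    not_lt.2 (Polynomial.natDegree_le_natDegree h1.le)
  simp only [ratMap, if_neg h2]
  rw [Polynomial.coeff_eq_zero_of_degree_lt, zero_div]
  rwa [← Polynomial.degree_eq_natDegree (RatFunc.denom_ne_zero F)]

/-- A denominator of degree `1` would have a zero in `K`, and a constant one would force `F = 0`. -/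
theorem HasRegularValues.two_le_ratDegree {F : RatFunc K} {g : K → K} (h : HasRegularValues F g)
    {z : K} (hz : g z ≠ 0) : 2 ≤ ratDegree F := by
  refine le_max_of_le_right ?_
  by_contra hlt
  have h1 := h.degree_num_lt
  rcases (by omega : F.denom.natDegree = 0 ∨ F.denom.natDegree = 1) with h0 | h0
  · rw [Polynomial.degree_eq_natDegree (RatFunc.denom_ne_zero F), h0] at h1
    have h2 : F.num = 0 := by
      rw [← Polynomial.degree_eq_bot]; exact Nat.WithBot.lt_zero_iff.1 (by simpa using h1)
    exact hz (by rw [← h.eval_div z, h2]; simp)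
  · obtain ⟨y, hy⟩ := Polynomial.exists_root_of_degree_eq_one
      (Polynomial.degree_eq_iff_natDegree_eq_of_pos one_pos |>.2 h0)
    exact h.denom_eval_ne_zero y hy

/-! ### Comparison with the formula over an extension containing a square root of the uniformizer.
-/

section BaseChange

variable {L : Type*} [Field L] [Algebra K L]

theorem baseChange_algebraMap (P : K[X]) :
    baseChange K L (algebraMap K[X] (RatFunc K) P) =
      algebraMap L[X] (RatFunc L) (P.map (algebraMap K L)) := by
  have := RatFunc.map_apply_div (K := K) (R := L) (Polynomial.mapRingHom (algebraMap K L))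
    (nonZeroDivisors_le_comap_nonZeroDivisors_of_injective _
      (Polynomial.map_injective _ (algebraMap K L).injective)) P 1
  simpa [baseChange, RatFunc.coe_mapRingHom_eq_coe_map] using this

theorem baseChange_X : baseChange K L RatFunc.X = RatFunc.X := by
  rw [← RatFunc.algebraMap_X, baseChange_algebraMap, Polynomial.map_X, RatFunc.algebraMap_X]

theorem baseChange_C (c : K) : baseChange K L (RatFunc.C c) = RatFunc.C (algebraMap K L c) := by
  rw [← RatFunc.algebraMap_C, baseChange_algebraMap, Polynomial.map_C, RatFunc.algebraMap_C]

theorem baseChange_linearFun (α β : K) :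
    baseChange K L (linearFun α β) = linearFun (algebraMap K L α) (algebraMap K L β) := by
  simp only [linearFun, map_add, map_mul, baseChange_X, baseChange_C]

theorem baseChange_bumpOfPow {a B : K} {b : L} {M : ℕ} (hb : b ≠ 0)
    (hB : algebraMap K L B = b ^ M) :
    baseChange K L (bumpOfPow a B M) = bump (algebraMap K L a) b M := by
  have hb' : (RatFunc.C b : RatFunc L) ^ M ≠ 0 := pow_ne_zero _ (by simpa using hb)
  simp only [bumpOfPow, bump, map_div₀, map_sub, map_pow, baseChange_X, baseChange_C, hB]
  rw [div_pow, one_sub_div hb', one_div_div]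

end BaseChange

end

/-! ### The chordal metric on the unit ball and at infinity -/

section

variable {K : Type*} [NormedField K] [IsUltrametricDist K]

theorem dist_pt_pt (z w : K) :
    dist (ProjLine.pt z) (ProjLine.pt w) = ‖z - w‖ / (max ‖z‖ 1 * max ‖w‖ 1) := by
  change ProjLine.chordal _ _ = _
  simp [ProjLine.chordal, ProjLine.wedge, ProjLine.size, ProjLine.coord]

theorem dist_pt_infty (z : K) :
    dist (ProjLine.pt z) ProjLine.infty = 1 / max ‖z‖ 1 := by
  change ProjLine.chordal _ _ = _
  simp [ProjLine.chordal, ProjLine.wedge, ProjLine.size, ProjLine.coord]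

theorem dist_pt_of_norm_le_one {z w : K} (hz : ‖z‖ ≤ 1) (hw : ‖w‖ ≤ 1) :
    dist (ProjLine.pt z) (ProjLine.pt w) = dist z w := by
  rw [dist_pt_pt, max_eq_right hz, max_eq_right hw, dist_eq_norm]; simp

theorem dist_pt_le (z w : K) : dist (ProjLine.pt z) (ProjLine.pt w) ≤ dist z w := by
  rw [dist_pt_pt, dist_eq_norm]
  exact div_le_self (norm_nonneg _) (one_le_mul_of_one_le_of_one_le (le_max_right _ _)
    (le_max_right _ _))

theorem norm_eq_of_norm_sub_lt {z w : K} (h : ‖z - w‖ < ‖w‖) : ‖z‖ = ‖w‖ := by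
  have h1 := IsUltrametricDist.norm_add_eq_max_of_norm_ne_norm (x := z - w) (y := w) h.ne
  rwa [sub_add_cancel, max_eq_right h.le] at h1

theorem norm_le_one_of_dist_pt_lt {z w : K} (hw : ‖w‖ ≤ 1)
    (h : dist (ProjLine.pt z) (ProjLine.pt w) < 1) : ‖z‖ ≤ 1 := by
  by_contra hz
  rw [not_le] at hz
  rw [dist_pt_pt, max_eq_left hz.le, max_eq_right hw, mul_one, div_lt_one (by linarith)] at h
  rw [norm_sub_rev] at h
  have := norm_eq_of_norm_sub_lt h
  linarith

omit [NormedField K] [IsUltrametricDist K] in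
theorem pt_injective : Function.Injective (ProjLine.pt : K → ProjLine K) :=
  fun _ _ h => by injection h

omit [NormedField K] [IsUltrametricDist K] in
theorem mem_inProjLine {S : Set K} {z : K} : ProjLine.pt z ∈ inProjLine S ↔ z ∈ S :=
  pt_injective.mem_set_image

/-- The unit ball is open in the projective line, and the chordal metric restricts to the usual one
on it. -/
theorem inProjLine_mem_nhds {S : Set K} {z : K} (hz : ‖z‖ ≤ 1) (hS : S ∈ 𝓝 z) :
    inProjLine S ∈ 𝓝 (ProjLine.pt z) := by
  obtain ⟨ε, hε, h⟩ := Metric.mem_nhds_iff.1 hS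
  refine Metric.mem_nhds_iff.2 ⟨min ε 1, by positivity, fun P hP => ?_⟩
  rw [mem_ball, lt_min_iff] at hP
  cases P with
  | pt w =>
    have hw := norm_le_one_of_dist_pt_lt hz hP.2
    rw [dist_pt_of_norm_le_one hw hz] at hP
    exact mem_inProjLine.2 (h hP.1)
  | infty =>
    rw [dist_comm, dist_pt_infty, max_eq_right hz] at hP
    norm_num at hP

theorem isComplete_inProjLine [CompleteSpace K] {S : Set K} (hS : IsClosed S)
    (h1 : ∀ z ∈ S, ‖z‖ ≤ 1) : IsComplete (inProjLine S) := by
  have hi : Isometry (fun z : S => ProjLine.pt (z : K)) := Isometry.of_dist_eq fun z w =>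
    dist_pt_of_norm_le_one (h1 _ z.2) (h1 _ w.2)
  have := hS.isComplete.completeSpace_coe
  have h2 := (isComplete_image_iff hi.isUniformInducing).2 (isComplete_univ (α := S))
  rwa [image_univ, ← Function.comp_def, range_comp, Subtype.range_coe] at h2

/-- A self-map of the projective line sending `∞` to `0`, given by a continuous function on `K`
that is bounded by `C / |z|` for `|z| > 1`, is continuous. -/
theorem continuous_of_decay {G : ProjLine K → ProjLine K} {g : K → K}
    (hG : ∀ z, G (.pt z) = .pt (g z)) (hinf : G .infty = .pt 0) (hg : Continuous g) {C : ℝ}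
    (hC : ∀ z, 1 < ‖z‖ → ‖g z‖ ≤ C / ‖z‖) : Continuous G := by
  rw [continuous_iff_continuousAt]
  intro P
  rw [Metric.continuousAt_iff]
  intro ε hε
  cases P with
  | pt z =>
    obtain ⟨δ, hδ, h⟩ := Metric.continuous_iff.1 hg z ε hε
    set R := max ‖z‖ 1 with hR
    have hR1 : 1 ≤ R := le_max_right _ _
    -- The bound `1 / R` forces `max ‖w‖ 1 ≤ R`; then `δ / R ^ 2` converts chordal closeness into
    -- `‖w - z‖ < δ`.
    refine ⟨min (1 / R) (δ / R ^ 2), by positivity, fun {Q} hQ => ?_⟩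
    rw [lt_min_iff] at hQ
    cases Q with
    | pt w =>
      rw [hG, hG]
      refine (dist_pt_le _ _).trans_lt (h w ?_)
      rw [dist_pt_pt, ← hR] at hQ
      have hw : max ‖w‖ 1 ≤ R := by
        refine max_le ?_ hR1
        by_contra hlt
        rw [not_le] at hlt
        have hz : ‖z‖ < ‖w‖ := (le_max_left _ _).trans_lt hlt
        have h2 : ‖w - z‖ = ‖w‖ := norm_eq_of_norm_sub_lt (by simpa using hz)
        have h3 := hQ.1
        rw [h2, max_eq_left (hR1.trans hlt.le), ← div_div, div_self (by linarith)] at h3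
        exact lt_irrefl _ h3
      have h4 := hQ.2
      have hw0 : 0 < max ‖w‖ 1 := by positivity
      rw [div_lt_div_iff₀ (by positivity) (by positivity)] at h4
      rw [dist_eq_norm]
      have h5 : δ * (max ‖w‖ 1 * R) ≤ δ * R ^ 2 := by
        rw [sq]; gcongr
      exact lt_of_mul_lt_mul_right (h4.trans_le h5) (by positivity)
    | infty =>
      rw [dist_comm, dist_pt_infty, ← hR] at hQ
      exact absurd hQ.1 (lt_irrefl _)
  | infty =>
    set C' := max C 1 with hC'
    have hC1 : 1 ≤ C' := le_max_right _ _
    refine ⟨min 1 (ε / C'), by positivity, fun {Q} hQ => ?_⟩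
    rw [lt_min_iff] at hQ
    cases Q with
    | infty => simpa using hε
    | pt w =>
      rw [dist_pt_infty] at hQ
      have hw : 1 < ‖w‖ := by
        by_contra hw
        rw [max_eq_right (not_lt.1 hw)] at hQ
        norm_num at hQ
      rw [max_eq_left hw.le] at hQ
      rw [hG, hinf]
      refine (dist_pt_le _ _).trans_lt ?_
      rw [dist_zero_right]
      calc ‖g w‖ ≤ C / ‖w‖ := hC w hw
        _ ≤ C' / ‖w‖ := by gcongr; exact le_max_left _ _
        _ = 1 / ‖w‖ * C' := by ring
        _ < ε / C' * C' := mul_lt_mul_of_pos_right hQ.2 (by linarith)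
        _ = ε := by field_simp

end

/-! ### Small perturbations of linear maps -/

section

variable {K : Type*} [NormedField K]

/-- `e` is bounded by `ε` and `ε`-Lipschitz on `S`. -/
structure SmallOn (S : Set K) (ε : ℝ) (e : K → K) : Prop where
  norm_le : ∀ z ∈ S, ‖e z‖ ≤ ε
  lip : ∀ z ∈ S, ∀ w ∈ S, ‖e z - e w‖ ≤ ε * ‖z - w‖

theorem SmallOn.mono {S S' : Set K} {ε ε' : ℝ} {e : K → K} (h : SmallOn S ε e) (hS : S' ⊆ S)
    (hε : ε ≤ ε') : SmallOn S' ε' e :=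
  ⟨fun z hz => (h.norm_le z (hS hz)).trans hε, fun z hz w hw => (h.lip z (hS hz) w (hS hw)).trans
    (mul_le_mul_of_nonneg_right hε (norm_nonneg _))⟩

theorem SmallOn.congr {S : Set K} {ε : ℝ} {e e' : K → K} (h : SmallOn S ε e)
    (he : ∀ z ∈ S, e' z = e z) : SmallOn S ε e' :=
  ⟨fun z hz => by rw [he z hz]; exact h.norm_le z hz,
    fun z hz w hw => by rw [he z hz, he w hw]; exact h.lip z hz w hw⟩

theorem SmallOn.neg {S : Set K} {ε : ℝ} {e : K → K} (h : SmallOn S ε e) :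
    SmallOn S ε (fun z => -e z) :=
  ⟨fun z hz => by rw [norm_neg]; exact h.norm_le z hz,
    fun z hz w hw => by rw [neg_sub_neg, norm_sub_rev]; exact h.lip z hz w hw⟩

variable [IsUltrametricDist K]

theorem norm_add_le_of_le {x y : K} {c : ℝ} (hx : ‖x‖ ≤ c) (hy : ‖y‖ ≤ c) : ‖x + y‖ ≤ c :=
  (IsUltrametricDist.norm_add_le_max _ _).trans (max_le hx hy)

theorem norm_sub_le_of_le {x y : K} {c : ℝ} (hx : ‖x‖ ≤ c) (hy : ‖y‖ ≤ c) : ‖x - y‖ ≤ c := by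
  rw [sub_eq_add_neg]; exact norm_add_le_of_le hx (by rwa [norm_neg])

theorem SmallOn.mul {S : Set K} {ε δ : ℝ} {e d : K → K} (he : SmallOn S ε e) (hd : SmallOn S δ d)
    (hε : 0 ≤ ε) : SmallOn S (ε * δ) (fun z => e z * d z) := by
  refine ⟨fun z hz => ?_, fun z hz w hw => ?_⟩
  · rw [norm_mul]
    exact mul_le_mul (he.norm_le z hz) (hd.norm_le z hz) (norm_nonneg _) hε
  · rw [show e z * d z - e w * d w = e z * (d z - d w) + (e z - e w) * d w by ring]
    refine norm_add_le_of_le ?_ ?_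
    · rw [norm_mul, mul_assoc]
      exact mul_le_mul (he.norm_le z hz) (hd.lip z hz w hw) (norm_nonneg _) hε
    · rw [norm_mul, show ε * δ * ‖z - w‖ = (ε * ‖z - w‖) * δ by ring]
      exact mul_le_mul (he.lip z hz w hw) (hd.norm_le w hw) (norm_nonneg _) (by positivity)

theorem SmallOn.sum {ι : Type*} (s : Finset ι) {S : Set K} {ε : ℝ} {e : ι → K → K} (hε : 0 ≤ ε)
    (h : ∀ i, SmallOn S ε (e i)) : SmallOn S ε (fun z => ∑ i ∈ s, e i z) := by
  refine ⟨fun z hz => ?_, fun z hz w hw => ?_⟩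
  · exact IsUltrametricDist.norm_sum_le_of_forall_le_of_nonneg hε fun i _ => (h i).norm_le z hz
  · rw [← Finset.sum_sub_distrib]
    exact IsUltrametricDist.norm_sum_le_of_forall_le_of_nonneg (by positivity)
      fun i _ => (h i).lip z hz w hw

theorem smallOn_linear (α β : K) :
    SmallOn (closedBall 0 1) (max ‖α‖ ‖β‖) (fun z => α * z + β) := by
  refine ⟨fun z hz => ?_, fun z hz w hw => ?_⟩
  · rw [mem_closedBall_zero_iff] at hz
    refine norm_add_le_of_le ?_ (le_max_right _ _)
    rw [norm_mul]
    exact (mul_le_of_le_one_right (norm_nonneg _) hz).trans (le_max_left _ _)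
  · rw [add_sub_add_right_eq_sub, ← mul_sub, norm_mul]
    exact mul_le_mul_of_nonneg_right (le_max_left _ _) (norm_nonneg _)

theorem norm_one_sub_eq_one {x : K} (hx : ‖x‖ < 1) : ‖1 - x‖ = 1 := by
  have := norm_eq_of_norm_sub_lt (z := 1 - x) (w := 1) (by simpa using hx)
  simpa using this

/-- If `|s| ≤ q < 1` and `s` is `C q`-Lipschitz then `s ^ m / (1 - s ^ m)` is of size `C q ^ m`. -/
theorem smallOn_pow_div {S : Set K} {s : K → K} {q C : ℝ} (hq0 : 0 ≤ q) (hq1 : q < 1) (hC : 1 ≤ C)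
    (hs : ∀ z ∈ S, ‖s z‖ ≤ q) (hl : ∀ z ∈ S, ∀ w ∈ S, ‖s z - s w‖ ≤ C * q * ‖z - w‖) {m : ℕ}
    (hm : m ≠ 0) : SmallOn S (C * q ^ m) (fun z => s z ^ m / (1 - s z ^ m)) := by
  have hn : ∀ k, ∀ z ∈ S, ‖s z ^ k‖ ≤ q ^ k := fun k z hz => by
    rw [norm_pow]; exact pow_le_pow_left₀ (norm_nonneg _) (hs z hz) k
  have h1 : ∀ z ∈ S, ‖1 - s z ^ m‖ = 1 := fun z hz =>
    norm_one_sub_eq_one ((hn m z hz).trans_lt (pow_lt_one₀ hq0 hq1 hm))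
  have hlip : ∀ k, ∀ z ∈ S, ∀ w ∈ S, ‖s z ^ k - s w ^ k‖ ≤ C * q ^ k * ‖z - w‖ := by
    intro k z hz w hw
    induction k with
    | zero => simp; positivity
    | succ k ih =>
      rw [show s z ^ (k + 1) - s w ^ (k + 1) =
        s z * (s z ^ k - s w ^ k) + (s z - s w) * s w ^ k by ring]
      refine norm_add_le_of_le ?_ ?_
      · rw [norm_mul, show C * q ^ (k + 1) * ‖z - w‖ = q * (C * q ^ k * ‖z - w‖) by ring]
        exact mul_le_mul (hs z hz) ih (norm_nonneg _) hq0
      · rw [norm_mul, show C * q ^ (k + 1) * ‖z - w‖ = (C * q * ‖z - w‖) * q ^ k by ring]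
        exact mul_le_mul (hl z hz w hw) (hn k w hw) (norm_nonneg _) (by positivity)
  refine ⟨fun z hz => ?_, fun z hz w hw => ?_⟩
  · rw [norm_div, h1 z hz, div_one]
    exact (hn m z hz).trans (le_mul_of_one_le_left (by positivity) hC)
  · have hz0 : 1 - s z ^ m ≠ 0 := norm_ne_zero_iff.1 (by rw [h1 z hz]; exact one_ne_zero)
    have hw0 : 1 - s w ^ m ≠ 0 := norm_ne_zero_iff.1 (by rw [h1 w hw]; exact one_ne_zero)
    rw [div_sub_div _ _ hz0 hw0, norm_div, norm_mul, h1 z hz, h1 w hw, one_mul, div_one,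
      show s z ^ m * (1 - s w ^ m) - (1 - s z ^ m) * s w ^ m = s z ^ m - s w ^ m by ring]
    exact hlip m z hz w hw

/-! ### Scaling and images of disks under a perturbed linear map. -/

section LinearPerturbation

variable {g e : K → K} {α β : K} {S : Set K} {ε : ℝ}

theorem SmallOn.norm_map_sub (he : SmallOn S ε e) (hg : ∀ z ∈ S, g z = α * z + β + e z)
    (hε : ε < ‖α‖) {z w : K} (hz : z ∈ S) (hw : w ∈ S) : ‖g z - g w‖ = ‖α‖ * ‖z - w‖ := by
  rcases eq_or_ne z w with rfl | hzw
  · simp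
  have h0 : 0 < ‖z - w‖ := norm_pos_iff.2 (sub_ne_zero.2 hzw)
  rw [← norm_mul]
  refine norm_eq_of_norm_sub_lt ?_
  rw [hg z hz, hg w hw, show α * z + β + e z - (α * w + β + e w) - α * (z - w) = e z - e w by ring,
    norm_mul]
  exact (he.lip z hz w hw).trans_lt (mul_lt_mul_of_pos_right hε h0)

omit [IsUltrametricDist K] in
theorem image_linear_closedBall (hα : α ≠ 0) (a : K) (r : ℝ) :
    (fun z => α * z + β) '' closedBall a r = closedBall (α * a + β) (‖α‖ * r) := by
  have hα' : 0 < ‖α‖ := norm_pos_iff.2 hα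
  ext y
  simp only [mem_image, mem_closedBall, dist_eq_norm]
  constructor
  · rintro ⟨z, hz, rfl⟩
    rw [add_sub_add_right_eq_sub, ← mul_sub, norm_mul]
    exact mul_le_mul_of_nonneg_left hz hα'.le
  · intro hy
    refine ⟨(y - β) / α, ?_, by field_simp; ring⟩
    rw [show (y - β) / α - a = (y - (α * a + β)) / α by field_simp; ring, norm_div,
      div_le_iff₀ hα', mul_comm r]
    exact hy

theorem mem_closedBall_add {a z y : K} {r : ℝ} (hz : z ∈ closedBall a r) (hy : ‖y‖ ≤ r) :
    z + y ∈ closedBall a r := by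
  rw [mem_closedBall, dist_eq_norm] at hz ⊢
  rw [add_sub_right_comm]
  exact norm_add_le_of_le hz hy

/-- Solving `g z = α * z₀ + β` amounts to finding a fixed point of `z ↦ z₀ - e z / α`, a contraction
of the ball into itself. -/
theorem SmallOn.image_closedBall [CompleteSpace K] {a : K} {r : ℝ}
    (he : SmallOn (closedBall a r) ε e) (hg : ∀ z ∈ closedBall a r, g z = α * z + β + e z)
    (hε0 : 0 ≤ ε) (hε : ε < ‖α‖) (hr : ε ≤ ‖α‖ * r) :
    g '' closedBall a r = (fun z => α * z + β) '' closedBall a r := by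
  have hα' : 0 < ‖α‖ := hε0.trans_lt hε
  have hα : α ≠ 0 := norm_pos_iff.1 hα'
  have hsm : ∀ z ∈ closedBall a r, ‖e z / α‖ ≤ r := fun z hz => by
    rw [norm_div, div_le_iff₀ hα', mul_comm]; exact (he.norm_le z hz).trans hr
  refine Subset.antisymm ?_ ?_
  · rintro _ ⟨z, hz, rfl⟩
    refine ⟨z + e z / α, mem_closedBall_add hz (hsm z hz), ?_⟩
    rw [hg z hz]; field_simp; ring
  · rintro _ ⟨z₀, hz₀, rfl⟩
    have hmaps : MapsTo (fun z => z₀ - e z / α) (closedBall a r) (closedBall a r) :=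
      fun z hz => by
        simp only [sub_eq_add_neg]
        exact mem_closedBall_add hz₀ (by rw [norm_neg]; exact hsm z hz)
    have hcon : ContractingWith (Real.toNNReal (ε / ‖α‖)) (hmaps.restrict _ _ _) := by
      refine ⟨by rw [Real.toNNReal_lt_one]; exact (div_lt_one hα').2 hε,
        LipschitzWith.of_dist_le_mul fun z w => ?_⟩
      rw [Real.coe_toNNReal _ (by positivity), Subtype.dist_eq, Subtype.dist_eq, dist_eq_norm,
        dist_eq_norm]
      simp only [MapsTo.val_restrict_apply]
      rw [sub_sub_sub_cancel_left, ← sub_div, norm_div, div_mul_eq_mul_div]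
      gcongr
      rw [norm_sub_rev (z : K)]
      exact he.lip _ w.2 _ z.2
    obtain ⟨z, hz, hfix, -⟩ := hcon.exists_fixedPoint' isClosed_closedBall.isComplete hmaps hz₀
      (edist_ne_top _ _)
    refine ⟨z, hz, ?_⟩
    have : z₀ - e z / α = z := hfix
    have h2 : e z = α * (z₀ - z) := by
      rw [show z₀ - z = e z / α by nth_rewrite 1 [← this]; ring]
      field_simp
    rw [hg z hz, h2]; ring

end LinearPerturbation

end

/-! ### Estimates for the gluing functions -/

section

variable {K : Type*} [NormedField K] {u : K}

/-- Discreteness of the value group: a strict inequality of absolute values gains a factor `‖u‖`. -/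
theorem IsUniformizer.norm_le_of_lt (hu : IsUniformizer u) {x y : K} (hx : x ≠ 0)
    (h : ‖x‖ < ‖y‖) : ‖x‖ ≤ ‖u‖ * ‖y‖ := by
  have hy : y ≠ 0 := norm_pos_iff.1 ((norm_nonneg _).trans_lt h)
  obtain ⟨h0, h1, hk⟩ := hu
  obtain ⟨k, hk'⟩ := hk x hx
  obtain ⟨l, hl⟩ := hk y hy
  rw [hk', hl] at h ⊢
  rw [← zpow_one_add₀ h0.ne']
  rw [zpow_lt_zpow_iff_right_of_lt_one₀ h0 h1] at h
  exact zpow_le_zpow_right_of_le_one₀ h0 h1.le (by omega)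

/-- With `b ^ 2 = x ^ 2 / u`, this is `((z - a) / b) ^ 2`. -/
def bumpArg (u a x z : K) : K := u * ((z - a) / x) ^ 2

/-- The value at `z` of the bump function of exponent `2 * m`. -/
noncomputable def bumpVal (u a x : K) (m : ℕ) (z : K) : K := 1 / (1 - bumpArg u a x z ^ m)

theorem norm_bumpArg (u a x z : K) : ‖bumpArg u a x z‖ = ‖u‖ * (‖z - a‖ / ‖x‖) ^ 2 := by
  simp [bumpArg]

theorem norm_bumpArg_le {a x z : K} (hx : x ≠ 0) (hz : z ∈ closedBall a ‖x‖) :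
    ‖bumpArg u a x z‖ ≤ ‖u‖ := by
  rw [mem_closedBall, dist_eq_norm] at hz
  rw [norm_bumpArg]
  exact mul_le_of_le_one_right (norm_nonneg _)
    (pow_le_one₀ (by positivity) ((div_le_one (norm_pos_iff.2 hx)).2 hz))

/-- Off the disk `‖z - a‖ / ‖x‖` is at least `1 / ‖u‖`; its square outweighs the prefactor `‖u‖`. -/
theorem IsUniformizer.norm_bumpArg_ge (hu : IsUniformizer u) {a x z : K} (hx : x ≠ 0)
    (hz : z ∉ closedBall a ‖x‖) : 1 / ‖u‖ ≤ ‖bumpArg u a x z‖ := by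
  rw [mem_closedBall, dist_eq_norm, not_le] at hz
  have h1 := hu.norm_le_of_lt hx hz
  have h0 := hu.1
  have hx' : 0 < ‖x‖ := norm_pos_iff.2 hx
  have h2 : 1 / ‖u‖ ≤ ‖z - a‖ / ‖x‖ := by
    rw [div_le_div_iff₀ h0 hx']; linarith
  rw [norm_bumpArg]
  calc 1 / ‖u‖ = ‖u‖ * (1 / ‖u‖) ^ 2 := by field_simp
    _ ≤ _ := by gcongr

theorem inv_le_of_one_div_le {q t : ℝ} (hq0 : 0 < q) (h : 1 / q ≤ t) : t⁻¹ ≤ q := by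
  rw [one_div] at h
  exact inv_le_of_inv_le₀ hq0 h

variable [IsUltrametricDist K]

omit [IsUltrametricDist K] in
theorem IsUniformizer.one_sub_bumpArg_pow_ne_zero (hu : IsUniformizer u) {a x : K} (hx : x ≠ 0)
    {m : ℕ} (hm : m ≠ 0) (z : K) : 1 - bumpArg u a x z ^ m ≠ 0 := by
  intro h
  have h1 : ‖bumpArg u a x z‖ ^ m = 1 := by rw [← norm_pow, ← sub_eq_zero.1 h, norm_one]
  rw [pow_eq_one_iff_of_nonneg (norm_nonneg _) hm] at h1
  by_cases hz : z ∈ closedBall a ‖x‖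
  · have := norm_bumpArg_le (u := u) hx hz
    linarith [hu.2.1]
  · have := hu.norm_bumpArg_ge hx hz
    rw [h1, div_le_one hu.1] at this
    linarith [hu.2.1]

omit [IsUltrametricDist K] in
theorem bumpVal_sub_one {a x z : K} {m : ℕ} (h : 1 - bumpArg u a x z ^ m ≠ 0) :
    bumpVal u a x m z - 1 = bumpArg u a x z ^ m / (1 - bumpArg u a x z ^ m) := by
  rw [bumpVal]; field_simp; ring

-- Off the disk this rewrites the bump in the small quantity `(bumpArg u a x z)⁻¹`, so that
-- `smallOn_pow_div` applies there too.
omit [IsUltrametricDist K] in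
theorem bumpVal_eq_neg {a x z : K} {m : ℕ} (h0 : bumpArg u a x z ≠ 0)
    (h : 1 - bumpArg u a x z ^ m ≠ 0) :
    bumpVal u a x m z =
      -((bumpArg u a x z)⁻¹ ^ m / (1 - (bumpArg u a x z)⁻¹ ^ m)) := by
  have h1 := pow_ne_zero m h0
  have h2 : bumpArg u a x z ^ m - 1 ≠ 0 := by
    rw [← neg_ne_zero, neg_sub]; exact h
  rw [bumpVal, inv_pow, ← one_div, one_sub_div h1, div_div_div_cancel_right₀ h1, ← div_neg,
    neg_sub]

theorem norm_bumpArg_sub_le {a x z w : K} (ha : ‖a‖ ≤ 1) (hz : ‖z‖ ≤ 1) (hw : ‖w‖ ≤ 1) :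
    ‖bumpArg u a x z - bumpArg u a x w‖ ≤ 1 / ‖x‖ ^ 2 * ‖u‖ * ‖z - w‖ := by
  have h : bumpArg u a x z - bumpArg u a x w =
      u * (1 / x ^ 2) * (z - w) * ((z - a) + (w - a)) := by
    simp only [bumpArg, div_pow]; ring
  rw [h, norm_mul]
  refine (mul_le_of_le_one_right (norm_nonneg _) (norm_add_le_of_le (norm_sub_le_of_le hz ha)
    (norm_sub_le_of_le hw ha))).trans (le_of_eq ?_)
  simp only [norm_mul, norm_div, norm_one, norm_pow]; ring

/-- The bump function is close to `1` on its disk. -/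
theorem IsUniformizer.smallOn_bumpVal_sub_one (hu : IsUniformizer u) {a x : K} (hx : x ≠ 0)
    (hsub : closedBall a ‖x‖ ⊆ closedBall 0 1) {m : ℕ} (hm : m ≠ 0) :
    SmallOn (closedBall a ‖x‖) (max 1 (1 / ‖x‖ ^ 2) * ‖u‖ ^ m)
      (fun z => bumpVal u a x m z - 1) := by
  have h1 : ∀ z ∈ closedBall a ‖x‖, ‖z‖ ≤ 1 := fun z hz => mem_closedBall_zero_iff.1 (hsub hz)
  refine (smallOn_pow_div hu.1.le hu.2.1 (le_max_left _ _) (fun z hz => norm_bumpArg_le hx hz)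
    (fun z hz w hw => (norm_bumpArg_sub_le (h1 a (mem_closedBall_self (norm_nonneg _)))
      (h1 z hz) (h1 w hw)).trans ?_) hm).congr
    (fun z _ => bumpVal_sub_one (hu.one_sub_bumpArg_pow_ne_zero hx hm z))
  gcongr
  exact le_max_right _ _

/-- The bump function is small outside of its disk. -/
theorem IsUniformizer.smallOn_bumpVal (hu : IsUniformizer u) {a x : K} (hx : x ≠ 0) (ha : ‖a‖ ≤ 1)
    {S : Set K} (hS : S ⊆ closedBall 0 1) (hd : Disjoint S (closedBall a ‖x‖)) {m : ℕ}
    (hm : m ≠ 0) :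
    SmallOn S (max 1 (1 / ‖x‖ ^ 2) * ‖u‖ ^ m) (bumpVal u a x m) := by
  have h1 : ∀ z ∈ S, ‖z‖ ≤ 1 := fun z hz => mem_closedBall_zero_iff.1 (hS hz)
  have h2 : ∀ z ∈ S, 1 / ‖u‖ ≤ ‖bumpArg u a x z‖ := fun z hz =>
    hu.norm_bumpArg_ge hx (disjoint_left.1 hd hz)
  have h0 : ∀ z ∈ S, bumpArg u a x z ≠ 0 := fun z hz =>
    norm_pos_iff.1 ((one_div_pos.2 hu.1).trans_le (h2 z hz))
  have h3 : ∀ z ∈ S, ‖(bumpArg u a x z)⁻¹‖ ≤ ‖u‖ := fun z hz => by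
    rw [norm_inv]; exact inv_le_of_one_div_le hu.1 (h2 z hz)
  refine (smallOn_pow_div (s := fun z => (bumpArg u a x z)⁻¹) hu.1.le hu.2.1 (le_max_left _ _) h3
    (fun z hz w hw => ?_) hm).neg.congr
    (fun z hz => bumpVal_eq_neg (h0 z hz) (hu.one_sub_bumpArg_pow_ne_zero hx hm z))
  rw [show (bumpArg u a x z)⁻¹ - (bumpArg u a x w)⁻¹ =
    (bumpArg u a x w - bumpArg u a x z) * ((bumpArg u a x z)⁻¹ * (bumpArg u a x w)⁻¹) by
      field_simp [h0 z hz, h0 w hw], norm_mul, norm_mul, norm_sub_rev]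
  have h4 := h3 z hz
  have h5 := h3 w hw
  refine (mul_le_of_le_one_right (norm_nonneg _) (mul_le_one₀ (h4.trans hu.2.1.le)
    (norm_nonneg _) (h5.trans hu.2.1.le))).trans ((norm_bumpArg_sub_le ha (h1 z hz)
    (h1 w hw)).trans ?_)
  gcongr
  exact le_max_right _ _

/-- Decay of the bump function outside of the unit ball. -/
theorem IsUniformizer.norm_bumpVal_le (hu : IsUniformizer u) {a x z : K} (hx : x ≠ 0)
    (hxu : ‖x‖ ≤ ‖u‖) (ha : ‖a‖ ≤ 1) (hz : 1 < ‖z‖) {m : ℕ} (hm : m ≠ 0) :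
    ‖bumpVal u a x m z‖ ≤ ‖u‖ ^ m / ‖z‖ ^ 2 := by
  have hx' : 0 < ‖x‖ := norm_pos_iff.2 hx
  have hza : ‖z - a‖ = ‖z‖ := norm_eq_of_norm_sub_lt (by
    rw [sub_sub_cancel_left, norm_neg]; exact ha.trans_lt hz)
  have h1 : ‖z‖ ^ 2 / ‖u‖ ≤ ‖bumpArg u a x z‖ := by
    rw [norm_bumpArg, hza, div_pow]
    have h0 := hu.1
    calc ‖z‖ ^ 2 / ‖u‖ = ‖u‖ * (‖z‖ ^ 2 / ‖u‖ ^ 2) := by field_simp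
      _ ≤ _ := by gcongr
  have hu0 := hu.1
  have h0 : bumpArg u a x z ≠ 0 := norm_pos_iff.1 (lt_of_lt_of_le (by positivity) h1)
  have h2 : ‖(bumpArg u a x z)⁻¹‖ ≤ ‖u‖ / ‖z‖ ^ 2 := by
    rw [norm_inv, ← inv_div]; exact inv_anti₀ (by positivity) h1
  have h3 : ‖(bumpArg u a x z)⁻¹ ^ m‖ ≤ ‖u‖ ^ m / ‖z‖ ^ 2 := by
    rw [norm_pow]
    refine (pow_le_pow_left₀ (norm_nonneg _) h2 m).trans ?_
    rw [div_pow]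
    gcongr
    exact le_self_pow₀ (one_le_pow₀ hz.le) hm
  have h4 : ‖u‖ ^ m / ‖z‖ ^ 2 < 1 := by
    rw [div_lt_one (by positivity)]
    exact (pow_lt_one₀ hu0.le hu.2.1 hm).trans (one_lt_pow₀ hz two_ne_zero)
  rw [bumpVal_eq_neg h0 (hu.one_sub_bumpArg_pow_ne_zero hx hm z), norm_neg, norm_div,
    norm_one_sub_eq_one (h3.trans_lt h4), div_one]
  exact h3

/-- The values of the function obtained by gluing the linear maps `α i * z + β i` on the disks
`closedBall (a i) ‖x i‖`. -/
noncomputable def glue {ι : Type*} [Fintype ι] (u : K) (a x α β : ι → K) (m : ℕ) (z : K) : K :=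
  ∑ i, (α i * z + β i) * bumpVal u (a i) (x i) m z

/-- On disk `i` the error is the sum over `k` of the `k`-th linear map times the bump `k` minus its
indicator, and each summand is small. `C` depends on the data but not on `m`. -/
theorem IsUniformizer.exists_glue_estimate (hu : IsUniformizer u) {ι : Type*} [Fintype ι]
    (a x α β : ι → K) (hx : ∀ i, x i ≠ 0) (hxu : ∀ i, ‖x i‖ ≤ ‖u‖)
    (hsub : ∀ i, closedBall (a i) ‖x i‖ ⊆ closedBall 0 1)
    (hd : ∀ i j, i ≠ j → Disjoint (closedBall (a i) ‖x i‖) (closedBall (a j) ‖x j‖)) :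
    ∃ C : ℝ, 0 ≤ C ∧ ∀ m : ℕ, m ≠ 0 →
      (∀ i, SmallOn (closedBall (a i) ‖x i‖) (C * ‖u‖ ^ m)
        (fun z => glue u a x α β m z - (α i * z + β i))) ∧
      (∀ z, ‖z‖ ≤ 1 → (∀ i, z ∉ closedBall (a i) ‖x i‖) →
        ‖glue u a x α β m z‖ ≤ C * ‖u‖ ^ m) ∧
      (∀ z, 1 < ‖z‖ → ‖glue u a x α β m z‖ ≤ C * ‖u‖ ^ m / ‖z‖) := by
  classical
  have ha : ∀ i, ‖a i‖ ≤ 1 := fun i =>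
    mem_closedBall_zero_iff.1 (hsub i (mem_closedBall_self (norm_nonneg _)))
  set A : ι → ℝ := fun i => max ‖α i‖ ‖β i‖ with hA
  have hA0 : ∀ i, 0 ≤ A i := fun i => (norm_nonneg _).trans (le_max_left _ _)
  set c : ι → ℝ := fun i => max 1 (1 / ‖x i‖ ^ 2) with hc
  have hc1 : ∀ i, 1 ≤ c i := fun i => le_max_left _ _
  have hAc : ∀ i, 0 ≤ A i * c i := fun i => mul_nonneg (hA0 i) (zero_le_one.trans (hc1 i))
  have hle : ∀ i, A i * c i ≤ ∑ k, A k * c k := fun i =>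
    Finset.single_le_sum (f := fun k => A k * c k) (fun k _ => hAc k) (Finset.mem_univ i)
  have hle' : ∀ i, A i ≤ ∑ k, A k * c k := fun i =>
    (le_mul_of_one_le_right (hA0 i) (hc1 i)).trans (hle i)
  have hC0 : 0 ≤ ∑ k, A k * c k := Finset.sum_nonneg fun k _ => hAc k
  have hu0 := hu.1
  refine ⟨∑ k, A k * c k, hC0, fun m hm => ⟨fun i => ?_, fun z hz hz' => ?_, fun z hz => ?_⟩⟩
  · have key : ∀ k, SmallOn (closedBall (a i) ‖x i‖) ((∑ k, A k * c k) * ‖u‖ ^ m)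
        (fun z => (α k * z + β k) * (bumpVal u (a k) (x k) m z - if k = i then 1 else 0)) := by
      intro k
      have h1 : SmallOn (closedBall (a i) ‖x i‖) (c k * ‖u‖ ^ m)
          (fun z => bumpVal u (a k) (x k) m z - if k = i then 1 else 0) := by
        by_cases hk : k = i
        · subst hk
          simpa only [if_true] using hu.smallOn_bumpVal_sub_one (hx k) (hsub k) hm
        · simpa only [if_neg hk, sub_zero] using
            hu.smallOn_bumpVal (hx k) (ha k) (hsub i) (hd i k (Ne.symm hk)) hm
      refine ((smallOn_linear (α k) (β k)).mono (hsub i) le_rfl |>.mul h1 (hA0 k)).mono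
        Subset.rfl ?_
      rw [← mul_assoc]
      exact mul_le_mul_of_nonneg_right (hle k) (by positivity)
    refine (SmallOn.sum Finset.univ (by positivity) key).congr fun z _ => ?_
    simp [glue, mul_sub, Finset.sum_sub_distrib]
  · refine IsUltrametricDist.norm_sum_le_of_forall_le_of_nonneg (by positivity) fun k _ => ?_
    have h1 := (hu.smallOn_bumpVal (hx k) (ha k) (S := {z}) (by simpa using hz)
      (by simpa using hz' k) hm).norm_le z rfl
    have h2 := (smallOn_linear (α k) (β k)).norm_le z (by simpa using hz)
    rw [norm_mul]
    calc _ ≤ A k * (c k * ‖u‖ ^ m) := mul_le_mul h2 h1 (norm_nonneg _) (hA0 k)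
      _ ≤ _ := by rw [← mul_assoc]; exact mul_le_mul_of_nonneg_right (hle k) (by positivity)
  · have hz0 : 0 < ‖z‖ := by linarith
    refine IsUltrametricDist.norm_sum_le_of_forall_le_of_nonneg (by positivity) fun k _ => ?_
    have h1 := hu.norm_bumpVal_le (hx k) (hxu k) (ha k) hz hm
    have h2 : ‖α k * z + β k‖ ≤ A k * ‖z‖ := by
      refine norm_add_le_of_le ?_ ?_
      · rw [norm_mul]; exact mul_le_mul_of_nonneg_right (le_max_left _ _) hz0.le
      · exact (le_max_right _ _).trans (le_mul_of_one_le_right (hA0 k) hz.le)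
    rw [norm_mul]
    calc _ ≤ A k * ‖z‖ * (‖u‖ ^ m / ‖z‖ ^ 2) := mul_le_mul h2 h1 (norm_nonneg _) (by
          have := hA0 k; positivity)
      _ = A k * ‖u‖ ^ m / ‖z‖ := by field_simp
      _ ≤ _ := by gcongr; exact hle' k

omit [IsUltrametricDist K] in
theorem bumpVal_eq_div (hu0 : u ≠ 0) {a x : K} (hx : x ≠ 0) (m : ℕ) (z : K) :
    bumpVal u a x m z = (x ^ 2 / u) ^ m / ((x ^ 2 / u) ^ m - (z - a) ^ (2 * m)) := by
  have h1 : (z - a) ^ (2 * m) = (x ^ 2 / u) ^ m * bumpArg u a x z ^ m := by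
    rw [← mul_pow, pow_mul]
    congr 1
    simp only [bumpArg]; field_simp
  have hB : (x ^ 2 / u) ^ m ≠ 0 := by positivity
  rw [h1, ← mul_one_sub, ← div_div, div_self hB, bumpVal]

/-- The rational function obtained by gluing the linear maps `α i * z + β i`. -/
noncomputable def glueRatFunc {ι : Type*} [Fintype ι] (u : K) (a x α β : ι → K) (m : ℕ) :
    RatFunc K :=
  ∑ i, linearFun (α i) (β i) * bumpOfPow (a i) ((x i ^ 2 / u) ^ m) (2 * m)

omit [IsUltrametricDist K] in
theorem IsUniformizer.hasRegularValues_glueRatFunc (hu : IsUniformizer u) {ι : Type*} [Fintype ι]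
    (a x α β : ι → K) (hx : ∀ i, x i ≠ 0) {m : ℕ} (hm : m ≠ 0) :
    HasRegularValues (glueRatFunc u a x α β m) (glue u a x α β m) := by
  have hu0 : u ≠ 0 := norm_pos_iff.1 hu.1
  refine HasRegularValues.sum _ fun i => ?_
  simp only [bumpVal_eq_div hu0 (hx i)]
  refine hasRegularValues_linearFun_mul_bumpOfPow (by omega) fun z h => ?_
  have h1 : bumpVal u (a i) (x i) m z = 0 := by
    rw [bumpVal_eq_div hu0 (hx i), h, div_zero]
  exact one_div_ne_zero (hu.one_sub_bumpArg_pow_ne_zero (hx i) hm z) h1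

end

/-! ### The Julia set of the glued rational function -/

/-- The given radius `r` need not be attained as a distance, so it may exceed the diameter. -/
theorem closedBall_eq_closedBall_diam {X : Type*} [PseudoMetricSpace X] [IsUltrametricDist X]
    {c a : X} {r : ℝ} (hr : 0 ≤ r) (ha : a ∈ closedBall c r) :
    closedBall c r = closedBall a (diam (closedBall c r)) := by
  have h := IsUltrametricDist.closedBall_eq_of_mem ha
  ext z
  refine ⟨fun hz => dist_le_diam_of_mem isBounded_closedBall hz ha, fun hz => ?_⟩
  rw [h]
  refine closedBall_subset_closedBall (diam_le_of_forall_dist_le hr fun y hy w hw => ?_) hz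
  rwa [IsUltrametricDist.closedBall_eq_of_mem hw] at hy

theorem HasRegularValues.continuous {K : Type*} [NormedField K] {F : RatFunc K} {g : K → K}
    (h : HasRegularValues F g) : Continuous g := by
  rw [show g = fun z => F.num.eval z / F.denom.eval z from funext fun z => (h.eval_div z).symm]
  exact F.num.continuous.div F.denom.continuous h.denom_eval_ne_zero

/-- The Wronskian is the numerator of the derivative, and a zero derivative is incompatible with
exact scaling by `c > 0` near `z`. -/
theorem HasRegularValues.wronskian_eval_ne_zero {K : Type*} [NontriviallyNormedField K]
    {F : RatFunc K} {g : K → K} (h : HasRegularValues F g) {z : K} {S : Set K} (hS : S ∈ 𝓝 z)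
    {c : ℝ} (hc : 0 < c) (hg : ∀ w ∈ S, ‖g w - g z‖ = c * ‖w - z‖) :
    (F.num.derivative * F.denom - F.num * F.denom.derivative).eval z ≠ 0 := by
  intro h0
  have hd : HasDerivAt g 0 z := by
    have h1 := (F.num.hasDerivAt z).div (F.denom.hasDerivAt z) (h.denom_eval_ne_zero z)
    simp only [Polynomial.eval_sub, Polynomial.eval_mul] at h0
    rw [h0, zero_div] at h1
    exact h1.congr_of_eventuallyEq (Eventually.of_forall fun w => (h.eval_div w).symm)
  rw [hasDerivAt_iff_isLittleO] at hd
  have h2 := (hd.def (half_pos hc)).and hS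
  obtain ⟨w, ⟨hw, hwS⟩, hne⟩ := ((h2.filter_mono nhdsWithin_le_nhds).and
    (self_mem_nhdsWithin (a := z) (s := {z}ᶜ))).exists
  rw [smul_zero, sub_zero, hg w hwS] at hw
  have : 0 < ‖w - z‖ := norm_pos_iff.2 (sub_ne_zero.2 hne)
  nlinarith

section

variable {K : Type*} [NormedField K] [IsUltrametricDist K]

theorem IsUniformizer.isMarkovRepeller [CompleteSpace K] {u : K} (hu : IsUniformizer u) {n : ℕ}
    {a x α β : Fin n → K} {g : K → K} {G : ProjLine K → ProjLine K} {ε : ℝ}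
    (hG : ∀ z, G (.pt z) = .pt (g z)) (hinf : G .infty = .pt 0) (hg : Continuous g)
    (hx : ∀ i, x i ≠ 0) (hsub : ∀ i, closedBall (a i) ‖x i‖ ⊆ closedBall 0 1)
    (hd₀ : ∀ i, Disjoint (closedBall (a i) ‖x i‖) (closedBall 0 ‖u‖))
    (hd : ∀ i j, i ≠ j → Disjoint (closedBall (a i) ‖x i‖) (closedBall (a j) ‖x j‖))
    (hε0 : 0 ≤ ε) (hεu : ε ≤ ‖u‖) (hεα : ∀ i, ε < ‖α i‖) (hεx : ∀ i, ε ≤ ‖α i‖ * ‖x i‖)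
    (hsm : ∀ i, SmallOn (closedBall (a i) ‖x i‖) ε (fun z => g z - (α i * z + β i)))
    (hsm₀ : SmallOn (closedBall 0 ‖u‖) ε (fun z => g z - z))
    (hin : ∀ z, ‖z‖ ≤ 1 → z ∉ closedBall (0 : K) ‖u‖ → (∀ i, z ∉ closedBall (a i) ‖x i‖) →
      ‖g z‖ ≤ ε)
    (hout : ∀ z, 1 < ‖z‖ → ‖g z‖ ≤ ε / ‖z‖)
    (hsucc : ∀ i, ∃ j, closedBall (a j) ‖x j‖ ⊂ closedBall (α i * a i + β i) (‖α i‖ * ‖x i‖)) :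
    IsMarkovRepeller G (fun i => inProjLine (closedBall (a i) ‖x i‖))
      (inProjLine (closedBall 0 ‖u‖)) (fun i => ‖α i‖) (fun i => ‖x i‖) ‖u‖ := by
  have hx' : ∀ i, 0 < ‖x i‖ := fun i => norm_pos_iff.2 (hx i)
  have hα : ∀ i, 0 < ‖α i‖ := fun i => hε0.trans_lt (hεα i)
  have h1 : ∀ i, ∀ z ∈ closedBall (a i) ‖x i‖, ‖z‖ ≤ 1 := fun i z hz =>
    mem_closedBall_zero_iff.1 (hsub i hz)
  have hgi : ∀ i z, g z = α i * z + β i + (g z - (α i * z + β i)) := fun i z => by ring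
  have hscale : ∀ i, ∀ z ∈ closedBall (a i) ‖x i‖, ∀ w ∈ closedBall (a i) ‖x i‖,
      ‖g z - g w‖ = ‖α i‖ * ‖z - w‖ := fun i z hz w hw =>
    (hsm i).norm_map_sub (fun z _ => hgi i z) (hεα i) hz hw
  have himg : ∀ i, g '' closedBall (a i) ‖x i‖ =
      closedBall (α i * a i + β i) (‖α i‖ * ‖x i‖) := fun i => by
    rw [(hsm i).image_closedBall (fun z _ => hgi i z) hε0 (hεα i) (hεx i),
      image_linear_closedBall (norm_pos_iff.1 (hα i))]
  have himgG : ∀ S, G '' inProjLine S = inProjLine (g '' S) := fun S => by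
    simp only [inProjLine, image_image, hG]
  -- If the image ball were no larger than a disk `j` that it meets, it would lie inside that disk.
  -- But it strictly contains some disk `k`: `k = j` contradicts strictness, `k ≠ j` contradicts
  -- disjointness.
  have hmark : ∀ i j, ∀ z ∈ closedBall (a i) ‖x i‖, g z ∈ closedBall (a j) ‖x j‖ →
      ‖x j‖ < ‖α i‖ * ‖x i‖ := by
    intro i j z hz hgz
    by_contra hle
    rw [not_lt] at hle
    have hB : g z ∈ closedBall (α i * a i + β i) (‖α i‖ * ‖x i‖) := by
      rw [← himg]; exact mem_image_of_mem g hz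
    have hBj : closedBall (α i * a i + β i) (‖α i‖ * ‖x i‖) ⊆ closedBall (a j) ‖x j‖ := by
      rw [IsUltrametricDist.closedBall_eq_of_mem hB, IsUltrametricDist.closedBall_eq_of_mem hgz]
      exact closedBall_subset_closedBall hle
    obtain ⟨k, hk⟩ := hsucc i
    by_cases hkj : k = j
    · subst hkj; exact hk.2 hBj
    · have hak := mem_closedBall_self (x := a k) (norm_nonneg (x k))
      exact disjoint_left.1 (hd k j hkj) hak (hBj (hk.1 hak))
  have hu0 := hu.1
  have h01 : ∀ z ∈ closedBall (0 : K) ‖u‖, ‖z‖ ≤ 1 := fun z hz =>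
    (mem_closedBall_zero_iff.1 hz).trans hu.2.1.le
  have hmaps₀ : ∀ z ∈ closedBall (0 : K) ‖u‖, g z ∈ closedBall (0 : K) ‖u‖ := fun z hz => by
    have := mem_closedBall_add hz ((hsm₀.norm_le z hz).trans hεu)
    rwa [add_sub_cancel] at this
  exact
  { continuous := continuous_of_decay hG hinf hg hout
    complete := fun i => isComplete_inProjLine isClosed_closedBall (h1 i)
    nonempty := fun i => ⟨_, mem_image_of_mem _ (mem_closedBall_self (norm_nonneg _))⟩
    r_pos := hx'
    c_pos := hα
    q_nonneg := hu0.le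
    q_lt_one := hu.2.1
    dist_le := by
      rintro i _ ⟨z, hz, rfl⟩ _ ⟨w, hw, rfl⟩
      refine (dist_pt_le z w).trans ?_
      rwa [IsUltrametricDist.closedBall_eq_of_mem hw] at hz
    exists_dist_eq := by
      rintro i _ ⟨z, hz, rfl⟩
      have hzx := mem_closedBall_add hz (le_refl ‖x i‖)
      refine ⟨_, mem_image_of_mem _ hzx, ?_⟩
      rw [dist_pt_of_norm_le_one (h1 i _ hz) (h1 i _ hzx)]
      simp
    dist_map := by
      rintro i j _ ⟨z, hz, rfl⟩ _ ⟨w, hw, rfl⟩ hgz hgw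
      rw [hG, mem_inProjLine] at hgz hgw
      rw [hG, hG, dist_pt_of_norm_le_one (h1 j _ hgz) (h1 j _ hgw),
        dist_pt_of_norm_le_one (h1 i _ hz) (h1 i _ hw), dist_eq_norm, dist_eq_norm]
      exact hscale i z hz w hw
    subset_image := by
      rintro i j _ ⟨z, hz, rfl⟩ hgz
      rw [hG, mem_inProjLine] at hgz
      rw [himgG, himg]
      refine image_mono ?_
      have hB : g z ∈ closedBall (α i * a i + β i) (‖α i‖ * ‖x i‖) := by
        rw [← himg]; exact mem_image_of_mem g hz
      rw [IsUltrametricDist.closedBall_eq_of_mem hB, IsUltrametricDist.closedBall_eq_of_mem hgz]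
      exact closedBall_subset_closedBall (hmark i j z hz hgz).le
    expanding := by
      rintro i j _ ⟨z, hz, rfl⟩ hgz
      rw [hG, mem_inProjLine] at hgz
      have := hu.norm_le_of_lt (x := x j) (y := α i * x i) (hx j)
        (by rw [norm_mul]; exact hmark i j z hz hgz)
      rwa [norm_mul] at this
    exists_subset_image := fun i => by
      obtain ⟨j, hj⟩ := hsucc i
      refine ⟨j, ?_⟩
      rw [himgG, himg]
      exact image_mono hj.1
    mapsTo := by
      rintro (z | _) hz
      · simp only [mem_inProjLine] at hz
        rw [hG, mem_inProjLine]
        by_cases hz0 : z ∈ closedBall (0 : K) ‖u‖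
        · exact hmaps₀ z hz0
        rw [mem_closedBall_zero_iff]
        rcases le_or_gt ‖z‖ 1 with hz1 | hz1
        · exact (hin z hz1 hz0 hz).trans hεu
        · exact (hout z hz1).trans ((div_le_self hε0 hz1.le).trans hεu)
      · rw [hinf, mem_inProjLine]
        exact mem_closedBall_self hu0.le
    disjoint := by
      rintro _ ⟨z, hz, rfl⟩ i hi
      exact disjoint_left.1 (hd₀ i) (mem_inProjLine.1 hi) hz
    dist_map_le := by
      rintro _ ⟨z, hz, rfl⟩ _ ⟨w, hw, rfl⟩
      rw [hG, hG, dist_pt_of_norm_le_one (h01 _ (hmaps₀ z hz)) (h01 _ (hmaps₀ w hw)),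
        dist_pt_of_norm_le_one (h01 z hz) (h01 w hw), dist_eq_norm, dist_eq_norm,
        -- On `E₀` the map is the identity plus an error with Lipschitz constant at most `1`.
        show g z - g w = (g z - z - (g w - w)) + (z - w) by ring]
      refine norm_add_le_of_le ((hsm₀.lip z hz w hw).trans ?_) le_rfl
      exact mul_le_of_le_one_left (norm_nonneg _) (hεu.trans hu.2.1.le) }

omit [IsUltrametricDist K] in
theorem baseChange_glueRatFunc {L : Type*} [Field L] [Algebra K L] {u : K} (hu : u ≠ 0) {s : L}
    (hs : s ^ 2 = algebraMap K L u) {ι : Type*} [Fintype ι] (a x α β : ι → K)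
    (hx : ∀ i, x i ≠ 0) (m : ℕ) :
    baseChange K L (glueRatFunc u a x α β m) =
      ∑ i, linearFun (algebraMap K L (α i)) (algebraMap K L (β i)) *
        bump (algebraMap K L (a i)) (algebraMap K L (x i) / s) (2 * m) := by
  have hs0 : s ≠ 0 := by
    rintro rfl
    rw [zero_pow two_ne_zero] at hs
    exact hu ((map_eq_zero (algebraMap K L)).1 hs.symm)
  rw [glueRatFunc, map_sum]
  refine Finset.sum_congr rfl fun i _ => ?_
  rw [map_mul, baseChange_linearFun, baseChange_bumpOfPow (b := algebraMap K L (x i) / s)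
    (div_ne_zero (by simpa using hx i) hs0)]
  rw [map_pow, map_div₀, map_pow, pow_mul, div_pow _ s, hs]

theorem closedBall_norm_mem_nhds {a x : K} (hx : x ≠ 0) {z : K} (hz : z ∈ closedBall a ‖x‖) :
    closedBall a ‖x‖ ∈ 𝓝 z :=
  (IsUltrametricDist.isOpen_closedBall a (norm_ne_zero_iff.2 hx)).mem_nhds hz

end

end NonarchDyn

/-! ### Choice of the exponent and assembly of the conclusions. -/

theorem mainTheorem5
    {K : Type*} [NontriviallyNormedField K] [IsUltrametricDist K] [CompleteSpace K] [CharZero K]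
    (u : K) (hu : IsUniformizer u)
    -- an extension field of `K` containing a square root `s` of `u`, e.g. `K(√u)`
    {L : Type*} [Field L] [Algebra K L] (s : L) (hs : s ^ 2 = algebraMap K L u)
    -- an admissible (0,1)-matrix
    {n : ℕ} (hn : 0 < n) (A : Matrix (Fin n) (Fin n) ℤ)
    (hA01 : ∀ i j, A i j = 0 ∨ A i j = 1) (hA : IsAdmissible A)
    -- a piecewise linear map linearly compatible to it
    (D : Fin n → Set K) (f : K → K) (hf : IsLinearlyCompatible A D f)
    (hD1 : ∀ i, D i ⊂ closedBall (0 : K) 1 ∧ Disjoint (D i) (closedBall (0 : K) ‖u‖))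
    (hD2 : ∀ i, (⋃ j ∈ {j | A i j ≠ 0}, D j) ⊂ f '' D i)
    -- the linear pieces `f_i (z) = α_i z + β_i`
    (α β : Fin n → K) (hαβ : ∀ i, ∀ z ∈ D i, f z = α i * z + β i)
    -- the choices `a_i`, `x_i` for `0 ≤ i ≤ n`, where `D_0` is the disk of radius `|u|` around `0`
    (a₀ x₀ : K) (ha₀ : a₀ ∈ closedBall (0 : K) ‖u‖)
    (hx₀ : ‖x₀‖ = diam (closedBall (0 : K) ‖u‖))
    (a x : Fin n → K) (ha : ∀ i, a i ∈ D i) (hx : ∀ i, ‖x i‖ = diam (D i)) :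
    ∃ M₀ : ℕ, ∀ M : ℕ, M₀ ≤ M → Even M →
      ∃ F : RatFunc K,
        baseChange K L F =
          linearFun 1 0 * bump (algebraMap K L a₀) (algebraMap K L x₀ / s) M +
          ∑ i, linearFun (algebraMap K L (α i)) (algebraMap K L (β i)) *
            bump (algebraMap K L (a i)) (algebraMap K L (x i) / s) M ∧
        IsHyperbolic F ∧
        (∀ z : K, ProjLine.pt z ∈ juliaSet F → F.denom.eval z ≠ 0 ∧
          (F.num.derivative * F.denom - F.num * F.denom.derivative).eval z ≠ 0) ∧
        (juliaSet F).Nonempty ∧ IsCompact (juliaSet F) ∧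
        juliaSet F ⊆ (⋃ i, inProjLine (D i)) ∧
        (∀ i, (juliaSet F ∩ inProjLine (D i)).Nonempty) ∧
        adjacencyMatrix (ratMap F) (fun i => inProjLine (D i)) = A := by
  have hu0 : 0 < ‖u‖ := hu.1
  have hdisk : ∀ i, D i = closedBall (a i) ‖x i‖ := fun i => by
    obtain ⟨⟨c, r, hr, hD⟩, -⟩ := hf.disk i
    have h := closedBall_eq_closedBall_diam hr (hD ▸ ha i)
    rwa [← hD, ← hx i] at h
  have hx0 : ∀ i, x i ≠ 0 := fun i => by
    obtain ⟨-, y, hy, hd⟩ := hf.disk i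
    rw [← norm_pos_iff, hx i, hd]
    exact norm_pos_iff.2 hy
  have hdiam : diam (closedBall (0 : K) ‖u‖) = ‖u‖ := by
    refine le_antisymm (diam_le_of_forall_dist_le hu0.le fun y hy w hw => ?_) ?_
    · rwa [IsUltrametricDist.closedBall_eq_of_mem hw] at hy
    · have := dist_le_diam_of_mem (isBounded_closedBall (x := (0 : K)) (r := ‖u‖))
        (x := u) (y := 0) (by simp) (by simp)
      rwa [dist_zero_right] at this
  have hx₀' : ‖x₀‖ = ‖u‖ := hx₀.trans hdiam
  have hx₀0 : x₀ ≠ 0 := norm_pos_iff.1 (hx₀' ▸ hu0)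
  -- Any point of an ultrametric disk is a centre, so `a₀` may replace `0`.
  have hdisk₀ : closedBall (0 : K) ‖u‖ = closedBall a₀ ‖x₀‖ := by
    rw [hx₀']; exact IsUltrametricDist.closedBall_eq_of_mem ha₀
  obtain rfl : D = fun i => closedBall (a i) ‖x i‖ := funext hdisk
  have hsub : ∀ i, closedBall (a i) ‖x i‖ ⊆ closedBall (0 : K) 1 := fun i => (hD1 i).1.1
  have hxu : ∀ i, ‖x i‖ ≤ ‖u‖ := fun i => by
    have h1 : ‖x i‖ < ‖(1 : K)‖ := by
      by_contra hle
      rw [not_lt, norm_one] at hle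
      refine (hD1 i).1.2 ?_
      rw [IsUltrametricDist.closedBall_eq_of_mem (hsub i (ha i))]
      exact closedBall_subset_closedBall hle
    simpa using hu.norm_le_of_lt (hx0 i) h1
  have hfimg : ∀ i, f '' closedBall (a i) ‖x i‖ =
      (fun z => α i * z + β i) '' closedBall (a i) ‖x i‖ := fun i => image_congr (hαβ i)
  have hss : ∀ i, ∃ j, closedBall (a j) ‖x j‖ ⊂ f '' closedBall (a i) ‖x i‖ := fun i => by
    obtain ⟨j, hj⟩ := hA.row_ne_zero i
    exact ⟨j, (subset_biUnion_of_mem (u := fun j => closedBall (a j) ‖x j‖) hj).trans_ssubset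
      (hD2 i)⟩
  -- If `α i = 0`, the image would be a single point, which has no non-empty proper subset.
  have hα : ∀ i, α i ≠ 0 := fun i h0 => by
    obtain ⟨j, hj⟩ := hss i
    have h1 : f '' closedBall (a i) ‖x i‖ = {β i} := by
      rw [hfimg, h0]
      simp
    rw [h1, ssubset_singleton_iff] at hj
    have := ha j
    simp only [hj] at this
    exact this
  have hball : ∀ i, f '' closedBall (a i) ‖x i‖ =
      closedBall (α i * a i + β i) (‖α i‖ * ‖x i‖) := fun i => by
    rw [hfimg, image_linear_closedBall (hα i)]
  -- The index `none` stands for `i = 0`, with the identity as its linear map.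
  let a' : Option (Fin n) → K := fun o => o.elim a₀ a
  let x' : Option (Fin n) → K := fun o => o.elim x₀ x
  let α' : Option (Fin n) → K := fun o => o.elim 1 α
  let β' : Option (Fin n) → K := fun o => o.elim 0 β
  have hx'0 : ∀ o, x' o ≠ 0 := by
    rintro (_ | i)
    exacts [hx₀0, hx0 i]
  obtain ⟨C, hC, hest⟩ := hu.exists_glue_estimate a' x' α' β' hx'0
    (by
      rintro (_ | i)
      exacts [hx₀'.le, hxu i])
    (by
      rintro (_ | i)
      · exact hdisk₀.symm.subset.trans (closedBall_subset_closedBall hu.2.1.le)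
      · exact hsub i)
    (by
      rintro (_ | i) (_ | j) hij
      · exact absurd rfl hij
      · have := (hD1 j).2.symm
        rwa [hdisk₀] at this
      · have := (hD1 i).2
        rwa [hdisk₀] at this
      · exact hf.disjoint i j fun h => hij (congrArg some h))
  have ht : Tendsto (fun m : ℕ => C * ‖u‖ ^ m) atTop (𝓝 0) := by
    simpa using (tendsto_pow_atTop_nhds_zero_of_lt_one hu0.le hu.2.1).const_mul C
  have hpos : ∀ i, 0 < ‖α i‖ := fun i => norm_pos_iff.2 (hα i)
  have hpos' : ∀ i, 0 < ‖α i‖ * ‖x i‖ := fun i => mul_pos (hpos i) (norm_pos_iff.2 (hx0 i))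
  obtain ⟨N, hN⟩ := eventually_atTop.1 ((ht.eventually_lt_const hu0).and
    ((eventually_all.2 fun i => ht.eventually_lt_const (hpos i)).and
      (eventually_all.2 fun i => ht.eventually_lt_const (hpos' i))))
  -- With `M = m + m` this gives both `m ≥ N` and `m ≠ 0`.
  refine ⟨2 * N + 2, fun M hM hMe => ?_⟩
  obtain ⟨m, rfl⟩ := hMe
  obtain ⟨hεu, hεα, hεx⟩ := hN m (by omega)
  have hm : m ≠ 0 := by omega
  obtain ⟨hsm, hin, hout⟩ := hest m hm
  have hε0 : 0 ≤ C * ‖u‖ ^ m := by positivity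
  have hF := hu.hasRegularValues_glueRatFunc a' x' α' β' hx'0 hm
  set F := glueRatFunc u a' x' α' β' m with hFdef
  set g := glue u a' x' α' β' m with hgdef
  have hrep := hu.isMarkovRepeller (a := a) (x := x) (α := α) (β := β) hF.ratMap_pt
    hF.ratMap_infty hF.continuous hx0 hsub (fun i => (hD1 i).2) hf.disjoint hε0 hεu.le hεα
    (fun i => (hεx i).le) (fun i => hsm (some i))
    (by rw [hdisk₀]; simpa [a', x', α', β'] using hsm none)
    (fun z hz hz0 hzi => hin z hz (by
      rintro (_ | i)
      · rw [hdisk₀] at hz0; exact hz0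
      · exact hzi i))
    hout
    (fun i => by
      obtain ⟨j, hj⟩ := hss i
      rw [hball] at hj
      exact ⟨j, hj⟩)
  have hgi : ∀ i z, g z = α i * z + β i + (g z - (α i * z + β i)) := fun i z => by ring
  have hscale : ∀ i, ∀ z ∈ closedBall (a i) ‖x i‖, ∀ w ∈ closedBall (a i) ‖x i‖,
      ‖g z - g w‖ = ‖α i‖ * ‖z - w‖ := fun i z hz w hw =>
    (hsm (some i)).norm_map_sub (fun z _ => hgi i z) (hεα i) hz hw
  have hinj : ∀ i, InjOn g (closedBall (a i) ‖x i‖) := fun i z hz w hw hzw => by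
    have h1 := hscale i z hz w hw
    rw [hzw, sub_self, norm_zero, eq_comm, mul_eq_zero] at h1
    exact sub_eq_zero.1 (norm_eq_zero.1 (h1.resolve_left (hpos i).ne'))
  have himg : ∀ i, g '' closedBall (a i) ‖x i‖ = f '' closedBall (a i) ‖x i‖ := fun i => by
    rw [hfimg]
    exact (hsm (some i)).image_closedBall (fun z _ => hgi i z) hε0 (hεα i) (hεx i).le
  have hJ : juliaSet F = IsMarkovRepeller.nonescaping (ratMap F)
      (fun i => inProjLine (closedBall (a i) ‖x i‖)) := hrep.compl_interior_eq
  have hJsub : ∀ P ∈ juliaSet F, ∃ i, ∃ z ∈ closedBall (a i) ‖x i‖, ProjLine.pt z = P :=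
    fun P hP => by
      rw [hJ] at hP
      exact hP 0
  have hnhds : ∀ i, ∀ z ∈ closedBall (a i) ‖x i‖, closedBall (a i) ‖x i‖ ∈ 𝓝 z :=
    fun i z hz => closedBall_norm_mem_nhds (hx0 i) hz
  refine ⟨F, ?_, ⟨?_, ?_⟩, ?_, ?_, ?_, ?_, ?_, ?_⟩
  · rw [hFdef, baseChange_glueRatFunc (norm_pos_iff.1 hu0) hs a' x' α' β' hx'0,
      Fintype.sum_option, ← two_mul]
    simp [a', x', α', β']
  · have hz := ha ⟨0, hn⟩
    have hw := mem_closedBall_add hz (le_refl ‖x ⟨0, hn⟩‖)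
    -- Injectivity on the disk prevents `g` from vanishing at two of its points.
    by_cases h0 : g (a ⟨0, hn⟩) = 0
    · refine hF.two_le_ratDegree (z := a ⟨0, hn⟩ + x ⟨0, hn⟩) fun h1 => hx0 ⟨0, hn⟩ ?_
      simpa using hinj _ hw hz (h1.trans h0.symm)
    · exact hF.two_le_ratDegree h0
  · rw [eq_empty_iff_forall_notMem]
    rintro P ⟨hcrit, hP⟩
    obtain ⟨i, z, hz, rfl⟩ := hJsub P hP
    refine hcrit _ (inProjLine_mem_nhds (mem_closedBall_zero_iff.1 (hsub i hz)) (hnhds i z hz)) ?_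
    rintro _ ⟨w, hw, rfl⟩ _ ⟨w', hw', rfl⟩ h
    rw [hF.ratMap_pt, hF.ratMap_pt] at h
    rw [hinj i hw hw' (pt_injective h)]
  · intro z hz
    obtain ⟨i, w, hw, hwz⟩ := hJsub _ hz
    obtain rfl := pt_injective hwz
    exact ⟨hF.denom_eval_ne_zero w, hF.wronskian_eval_ne_zero (hnhds i w hw) (hpos i)
      fun y hy => hscale i y hy w hw⟩
  · rw [hJ]
    exact (hrep.nonempty_nonescaping ⟨0, hn⟩).mono inter_subset_left
  · rw [hJ]
    exact hrep.isCompact_nonescaping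
  · intro P hP
    exact mem_iUnion.2 (hJsub P hP)
  · intro i
    rw [hJ]
    exact hrep.nonempty_nonescaping i
  · ext i j
    have h1 : inProjLine (closedBall (a j) ‖x j‖) ⊆
        ratMap F '' inProjLine (closedBall (a i) ‖x i‖) ↔ A i j = 1 := by
      rw [← hf.transition i j, ← himg i, show ratMap F '' inProjLine (closedBall (a i) ‖x i‖) =
        inProjLine (g '' closedBall (a i) ‖x i‖) by
          simp only [inProjLine, image_image, hF.ratMap_pt]]
      exact image_subset_image_iff pt_injective
    simp only [adjacencyMatrix, Matrix.of_apply, h1]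
    rcases hA01 i j with h | h <;> simp [h]
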